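/- Let $\gamma_m$ denote the standard Gaussian measure $(2\pi)^{-m/2}e^{-|x|^2/2}\,dx$ on an $m$-dimensional Euclidean space. A probability density on $(\mathbb{R}^m,d\gamma_m)$ is a measurable function $\rho\ge 0$ with $\int\rho\,d\gamma_m=1$, and its entropy is $S(\rho)=-\int\rho\ln\rho\,d\gamma_m\in[-\infty,0]$. Let $V_1,\dots,V_N$ be nonzero linear subspaces of $\mathbb{R}^n$, let $d_j=\dim V_j$, and let $P_j$ be the orthogonal projection of $\mathbb{R}^n$ onto $V_j$. For a probability density $\rho$ on $(\mathbb{R}^n,d\gamma_n)$ let $\rho_{V_j}$ be its marginal density on $(V_j,d\gamma_{d_j})$, that is, $\rho_{V_j}(y)=\int_{V_j^\perp}\rho(y+z)\,d\gamma_{n-d_j}(z)$. Let $1\le p_j<\infty$ for $j=1,\dots,N$. There exists a finite constant $C>0$ such that $$\sum_{j=1}^N\frac1{p_j}S(\rho_{V_j})\ \ge\ S(\rho)-\ln C$$ for all probability densities $\rho$ on $(\mathbb{R}^n,d\gamma_n)$ if and only if $$\sum_{j=1}^N\frac1{p_j}P_j\ \le\ I$$ in the sense of quadratic forms; and in this case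 the best (smallest) such constant is $C=1$, i.e. $\ln C=0$: the inequality holds for all $\rho$ with $C=1$ and with no smaller $C>0$. -/

import Mathlib

open MeasureTheory ProbabilityTheory

noncomputable section

/-- `ρ` is a probability density on the Gaussian space `(E, dγ)`, where `γ = stdGaussian E` is the
standard Gaussian measure `(2π)^(-m/2) exp(-|x|²/2) dx`, `m = dim E`. (The value `1` of the integral
forces `ρ` to be integrable.) -/
structure IsGaussDensity {E : Type*} [NormedAddCommGroup E] [InnerProductSpace ℝ E]
    [FiniteDimensional ℝ E] [MeasurableSpace E] (ρ : E → ℝ) : Prop where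
  measurable : Measurable ρ
  nonneg : ∀ x, 0 ≤ ρ x
  integral_eq_one : ∫ x, ρ x ∂(stdGaussian E) = 1

open Classical in
/-- The entropy `S(ρ) = -∫ ρ ln ρ dγ` of a probability density on `(E, dγ)`, with values in
`[-∞, 0]`. Since `-r ln r ≤ 1/e` for `r ≥ 0` and `γ` is a probability measure, the positive part of
`-ρ ln ρ` is always integrable; so the integral has the value `-∞` exactly when `ρ ln ρ` is not
integrable. -/
def gaussEntropy {E : Type*} [NormedAddCommGroup E] [InnerProductSpace ℝ E]
    [FiniteDimensional ℝ E] [MeasurableSpace E] (ρ : E → ℝ) : EReal :=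
  if Integrable (fun x => ρ x * Real.log (ρ x)) (stdGaussian E) then
    ((-∫ x, ρ x * Real.log (ρ x) ∂(stdGaussian E) : ℝ) : EReal)
  else ⊥

/-- The marginal density on `(V, dγ_V)` of a density `ρ` on `(E, dγ)`: since
`γ = γ_V ⊗ γ_{Vᗮ}` under `E = V ⊕ Vᗮ`, it is obtained by integrating out the component in `Vᗮ`. -/
def gaussMarginal {E : Type*} [NormedAddCommGroup E] [InnerProductSpace ℝ E]
    [FiniteDimensional ℝ E] [MeasurableSpace E] (V : Submodule ℝ E) (ρ : E → ℝ) : V → ℝ :=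
  fun y => ∫ z : Vᗮ, ρ ((y : E) + (z : E)) ∂(stdGaussian Vᗮ)

/-- The inequality `∑ⱼ (1/pⱼ) S(ρ_{Vⱼ}) ≥ S(ρ) - ln C` holds for all probability densities `ρ`
on `(E, dγ)`. -/
def GaussSubadditivity {E : Type*} [NormedAddCommGroup E] [InnerProductSpace ℝ E]
    [FiniteDimensional ℝ E] [MeasurableSpace E] {N : ℕ} (V : Fin N → Submodule ℝ E)
    (p : Fin N → ℝ) (C : ℝ) : Prop :=
  ∀ ρ : E → ℝ, IsGaussDensity ρ →
    ∑ j, ((1 / p j : ℝ) : EReal) * gaussEntropy (gaussMarginal (V j) ρ)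
      ≥ gaussEntropy ρ - ((Real.log C : ℝ) : EReal)

end

/-!
Write `c_j = 1 / p_j`.

**Necessity.** The density of the standard Gaussian translated by `w` has entropy `-‖w‖² / 2`, and
its marginal on `V_j` is the translate by `P_j w`. The inequality with constant `C` therefore reads
`∑ c_j ‖P_j w‖² / 2 ≤ ‖w‖² / 2 + log C`. Scaling `w` to infinity gives `∑ c_j P_j ≤ I`, and `w = 0`
gives `C ≥ 1`.

**Sufficiency.** By Gibbs' variational principle `-S(ρ)` is the supremum of
`∫ ρ g dγ - log ∫ exp g dγ` over bounded `g`. Testing `ρ` on `g = ∑ c_j g_j ∘ P_j` reduces the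
entropy inequality to the Brascamp–Lieb inequality
`∫ ∏ (f_j ∘ P_j)^{c_j} dγ ≤ ∏ (∫ f_j dγ_{V_j})^{c_j}` for
`f_j = exp g_j` (`sum_gibbs_marginal_le_of_arctan`), and it suffices to prove the latter for a class
of smooth `f_j` that is rich enough to approach the suprema (`exists_tendsto_gibbs_smooth`,
`exists_tendsto_gibbs_entropy`).

The Brascamp–Lieb inequality is proved by a heat flow in discrete time, which needs no
differentiation under the integral and no evolution equation. Over one step of length `s`, expand
`∏ F_j(x + √s Y)^{c_j}` relative to the averages of `F_j(x + √s Y)`. The first-order terms have mean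
zero. With `v_j ∈ V_j` the normalised gradients, the second-order term has mean
`s (‖∑ c_j v_j‖² - ∑ c_j ‖v_j‖²) / 2`, which is nonpositive because this is the dual form of
`∑ c_j P_j ≤ I` (`norm_sum_smul_sq_le_of_sum_starProjection_le`). So one step satisfies the
inequality up to a factor `1 + O(s^{3/2})` (`exists_heat_prod_rpow_le`). The constants are uniform
along the flow, since the bounds in `QuadRegular` survive averaging of translates, and `m` steps of
length `1 / m` lose only a factor `1 + O(m^{-1/2})` (`integral_prod_rpow_le_of_quadRegular`).
-/

open scoped RealInnerProductSpace

/-! ### Identities for the standard Gaussian measure -/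

section GaussianIdentities

variable {E : Type*} [NormedAddCommGroup E] [InnerProductSpace ℝ E] [FiniteDimensional ℝ E]
  [MeasurableSpace E] [BorelSpace E]

/-- The factorisation `γ = γ_V ⊗ γ_{Vᗮ}` under `E = V ⊕ Vᗮ`. -/
lemma map_prod_add_stdGaussian (V : Submodule ℝ E) :
    ((stdGaussian V).prod (stdGaussian Vᗮ)).map (fun q => (q.1 : E) + (q.2 : E)) =
      stdGaussian E := by
  have hm : Measurable (fun q : V × Vᗮ => (q.1 : E) + (q.2 : E)) := by fun_prop
  have : IsProbabilityMeasure (((stdGaussian V).prod (stdGaussian Vᗮ)).map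
      (fun q => (q.1 : E) + (q.2 : E))) := Measure.isProbabilityMeasure_map hm.aemeasurable
  apply Measure.ext_of_charFun
  ext t
  have h1 := charFun_stdGaussian (V.orthogonalProjectionOnto t)
  have h2 := charFun_stdGaussian (Vᗮ.orthogonalProjectionOnto t)
  rw [charFun_apply] at h1 h2
  rw [charFun_stdGaussian, charFun_apply, integral_map hm.aemeasurable (by fun_prop)]
  have h3 (q : V × Vᗮ) : Complex.exp (⟪(q.1 : E) + (q.2 : E), t⟫ * Complex.I) =
      Complex.exp (⟪q.1, V.orthogonalProjectionOnto t⟫ * Complex.I) *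
      Complex.exp (⟪q.2, Vᗮ.orthogonalProjectionOnto t⟫ * Complex.I) := by
    rw [← Complex.exp_add, Submodule.inner_orthogonalProjectionOnto_eq_of_mem_left,
      Submodule.inner_orthogonalProjectionOnto_eq_of_mem_left, inner_add_left]
    push_cast; ring_nf
  simp_rw [h3]
  rw [integral_prod_mul (fun a : V => Complex.exp (⟪a, V.orthogonalProjectionOnto t⟫ * Complex.I))
    (fun b : Vᗮ => Complex.exp (⟪b, Vᗮ.orthogonalProjectionOnto t⟫ * Complex.I)), h1, h2,
    ← Complex.exp_add]
  congr 1
  have h4 := V.norm_sq_eq_add_norm_sq_projection t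
  rw [← Complex.ofReal_pow, ← Complex.ofReal_pow, ← Complex.ofReal_pow, h4]
  push_cast; ring

/-- Stability of the Gaussian law under sums: `√s Y + √t Y'` has the law of `√(s + t) Y`. -/
lemma map_prod_smul_add_stdGaussian {s t : ℝ} (hs : 0 ≤ s) (ht : 0 ≤ t) :
    ((stdGaussian E).prod (stdGaussian E)).map (fun q => √s • q.1 + √t • q.2) =
      (stdGaussian E).map (fun y => √(s + t) • y) := by
  have hm : Measurable (fun q : E × E => √s • q.1 + √t • q.2) := by fun_prop
  have : IsProbabilityMeasure (((stdGaussian E).prod (stdGaussian E)).map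
      (fun q => √s • q.1 + √t • q.2)) := Measure.isProbabilityMeasure_map hm.aemeasurable
  have : IsProbabilityMeasure ((stdGaussian E).map (fun y => √(s + t) • y)) :=
    Measure.isProbabilityMeasure_map (by fun_prop)
  apply Measure.ext_of_charFun
  ext u
  have h1 := charFun_stdGaussian (√s • u)
  have h2 := charFun_stdGaussian (√t • u)
  rw [charFun_apply] at h1 h2
  rw [charFun_map_smul, charFun_stdGaussian, charFun_apply,
    integral_map hm.aemeasurable (by fun_prop)]
  have h3 (q : E × E) : Complex.exp (⟪√s • q.1 + √t • q.2, u⟫ * Complex.I) =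
      Complex.exp (⟪q.1, √s • u⟫ * Complex.I) * Complex.exp (⟪q.2, √t • u⟫ * Complex.I) := by
    rw [← Complex.exp_add, inner_add_left, inner_smul_left, inner_smul_left, inner_smul_right,
      inner_smul_right]
    simp; ring_nf
  simp_rw [h3]
  rw [integral_prod_mul (fun a : E => Complex.exp (⟪a, √s • u⟫ * Complex.I))
    (fun b : E => Complex.exp (⟪b, √t • u⟫ * Complex.I)), h1, h2, ← Complex.exp_add]
  congr 1
  simp_rw [norm_smul, ← Complex.ofReal_pow, mul_pow, Real.norm_of_nonneg (Real.sqrt_nonneg _),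
    Real.sq_sqrt hs, Real.sq_sqrt ht, Real.sq_sqrt (add_nonneg hs ht)]
  push_cast; ring

lemma map_inner_stdGaussian (w : E) :
    (stdGaussian E).map (fun x => ⟪w, x⟫) = gaussianReal 0 (‖w‖₊ ^ 2) := by
  have h := IsGaussian.map_eq_gaussianReal (μ := stdGaussian E) (innerSL ℝ w)
  rw [variance_dual_stdGaussian, integral_strongDual_stdGaussian] at h
  simp only [innerSL_apply_norm] at h
  rw [Real.toNNReal_pow (norm_nonneg w), norm_toNNReal] at h
  exact h

lemma integral_inner_sq_stdGaussian (w : E) : ∫ x, ⟪w, x⟫ ^ 2 ∂(stdGaussian E) = ‖w‖ ^ 2 := by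
  have h := variance_dual_stdGaussian (innerSL ℝ w)
  rw [variance_eq_integral (by fun_prop), integral_strongDual_stdGaussian] at h
  simpa using h

lemma integral_inner_stdGaussian (w : E) : ∫ x, ⟪w, x⟫ ∂(stdGaussian E) = 0 := by
  simpa using integral_strongDual_stdGaussian (innerSL ℝ w)

lemma integrable_norm_pow_stdGaussian (k : ℕ) :
    Integrable (fun x : E => ‖x‖ ^ k) (stdGaussian E) :=
  (IsGaussian.memLp_id (stdGaussian E) k (by simp)).integrable_norm_pow'

lemma integral_exp_inner_stdGaussian (w : E) :
    ∫ x, Real.exp ⟪w, x⟫ ∂(stdGaussian E) = Real.exp (‖w‖ ^ 2 / 2) := by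
  have h := mgf_gaussianReal (map_inner_stdGaussian w) 1
  simpa [mgf] using h

lemma integrable_inner_mul_exp_inner_stdGaussian (w : E) :
    Integrable (fun x => ⟪w, x⟫ * Real.exp ⟪w, x⟫) (stdGaussian E) := by
  have h := integrable_pow_mul_exp_of_mem_interior_integrableExpSet (X := id)
    (μ := gaussianReal 0 (‖w‖₊ ^ 2)) (v := 1) (by simp [integrableExpSet_id_gaussianReal]) 1
  rw [← map_inner_stdGaussian, integrable_map_measure (by fun_prop) (by fun_prop)] at h
  simpa [Function.comp_def] using h

lemma integral_inner_mul_exp_inner_stdGaussian (w : E) :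
    ∫ x, ⟪w, x⟫ * Real.exp ⟪w, x⟫ ∂(stdGaussian E) = ‖w‖ ^ 2 * Real.exp (‖w‖ ^ 2 / 2) := by
  have h := hasDerivAt_mgf (X := id)
    (μ := gaussianReal 0 (‖w‖₊ ^ 2)) (t := 1) (by simp [integrableExpSet_id_gaussianReal])
  rw [mgf_id_gaussianReal] at h
  have h' : HasDerivAt (fun t : ℝ => Real.exp (0 * t + ((‖w‖₊ ^ 2 : NNReal) : ℝ) * t ^ 2 / 2))
      (‖w‖ ^ 2 * Real.exp (‖w‖ ^ 2 / 2)) 1 := by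
    have := (((hasDerivAt_pow 2 (1 : ℝ)).const_mul (‖w‖ ^ 2)).div_const 2).exp
    convert this using 1
    · ext; simp
    · simp; ring
  have := h.unique h'
  rw [← this, ← map_inner_stdGaussian, integral_map (by fun_prop) (by fun_prop)]
  simp

end GaussianIdentities

/-! ### Elementary inequalities -/

lemma abs_exp_sub_quadratic_le (x : ℝ) :
    |Real.exp x - (1 + x + x ^ 2 / 2)| ≤ |x| ^ 3 * Real.exp |x| := by
  have h := Complex.norm_exp_sub_sum_le_norm_mul_exp (x : ℂ) 3
  simp only [Finset.sum_range_succ, Finset.sum_range_zero, Complex.norm_real, Real.norm_eq_abs] at h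
  rw [← Real.norm_eq_abs (_ - _), ← Complex.norm_real]
  convert h using 2
  push_cast [Nat.factorial]
  simp

lemma abs_log_le_and_abs_log_sub_le {R w : ℝ} (hR : 1 ≤ R) (hw : R⁻¹ ≤ 1 + w) :
    |Real.log (1 + w)| ≤ R * |w| ∧ |Real.log (1 + w) - w| ≤ R * w ^ 2 := by
  have hR0 : 0 < R := by linarith
  have hpos : 0 < 1 + w := lt_of_lt_of_le (inv_pos.2 hR0) hw
  have h1 : Real.log (1 + w) ≤ w := by linarith [Real.log_le_sub_one_of_pos hpos]
  have h2 : 1 - (1 + w)⁻¹ ≤ Real.log (1 + w) := Real.one_sub_inv_le_log_of_pos hpos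
  have h3 : (1 + w)⁻¹ ≤ R := inv_le_of_inv_le₀ hR0 hw
  have h4 : 1 - (1 + w)⁻¹ = w * (1 + w)⁻¹ := by field_simp; ring
  have h5 : 1 - (1 + w)⁻¹ = w - w ^ 2 * (1 + w)⁻¹ := by field_simp; ring
  have h6 : 0 < (1 + w)⁻¹ := inv_pos.2 hpos
  have h7 : w ^ 2 * (1 + w)⁻¹ ≤ R * w ^ 2 := by
    rw [mul_comm R]; exact mul_le_mul_of_nonneg_left h3 (sq_nonneg w)
  constructor
  · rw [abs_le]
    constructor
    · have : |w| * (1 + w)⁻¹ ≤ |w| * R := mul_le_mul_of_nonneg_left h3 (abs_nonneg w)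
      have h8 : -|w| * (1 + w)⁻¹ ≤ w * (1 + w)⁻¹ :=
        mul_le_mul_of_nonneg_right (neg_abs_le w) h6.le
      linarith
    · nlinarith [le_abs_self w, abs_nonneg w]
  · rw [abs_le]
    constructor
    · linarith
    · nlinarith [sq_nonneg w]

lemma abs_sum_mul_le {ι : Type*} (s : Finset ι) {c x : ι → ℝ} {B : ℝ} (hc : ∀ j, 0 ≤ c j)
    (hx : ∀ j, |x j| ≤ B) : |∑ j ∈ s, c j * x j| ≤ (∑ j ∈ s, c j) * B := by
  rw [Finset.sum_mul]
  refine (Finset.abs_sum_le_sum_abs _ _).trans (Finset.sum_le_sum fun j _ => ?_)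
  rw [abs_mul, abs_of_nonneg (hc j)]
  exact mul_le_mul_of_nonneg_left (hx j) (hc j)

/-- Second-order expansion of `∏ (1 + w_j)^{c_j}` with a uniform cubic error. When `w_j` is `ℓ_j` up
to second order in `t`, the second-order part is `((∑ c_j ℓ_j)² - ∑ c_j ℓ_j²) / 2`. -/
lemma exists_exp_sum_log_le {ι : Type*} [Fintype ι] {c : ι → ℝ} (hc : ∀ j, 0 ≤ c j)
    {R : ℝ} (hR : 1 ≤ R) :
    ∃ C : ℝ, 0 ≤ C ∧ ∀ (t : ℝ) (ℓ w : ι → ℝ), 0 ≤ t → (∀ j, R⁻¹ ≤ 1 + w j) → (∀ j, 1 + w j ≤ R) →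
      (∀ j, |ℓ j| ≤ R * t) → (∀ j, |w j| ≤ R * t) → (∀ j, |w j - ℓ j| ≤ R * t ^ 2) →
      Real.exp (∑ j, c j * Real.log (1 + w j)) ≤ 1 + ∑ j, c j * w j
        + ((∑ j, c j * ℓ j) ^ 2 - ∑ j, c j * ℓ j ^ 2) / 2 + C * t ^ 3 := by
  have hR0 : 0 < R := by linarith
  set S := ∑ j, c j with hS
  have hS0 : 0 ≤ S := Finset.sum_nonneg fun j _ => hc j
  refine ⟨S ^ 3 * R ^ 6 * Real.exp (S * R ^ 2) + S * R ^ 6 * Real.exp (R ^ 2)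
    + 2 * S ^ 2 * R ^ 5 + 2 * S * R ^ 5, by positivity, ?_⟩
  intro t ℓ w ht hw1 hw2 hl hw hwl
  -- In the variables `L j = log (1 + w j)` both sides are exponentials, and the claim is a
  -- comparison of Taylor expansions of `exp`.
  set L : ι → ℝ := fun j => Real.log (1 + w j) with hL
  have hLt j : |L j| ≤ R ^ 2 * t := by
    refine (abs_log_le_and_abs_log_sub_le hR (hw1 j)).1.trans ?_
    nlinarith [hw j]
  have hLR j : |L j| ≤ R ^ 2 := by
    refine (abs_log_le_and_abs_log_sub_le hR (hw1 j)).1.trans ?_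
    have : |w j| ≤ R := abs_le.2 ⟨by linarith [hw1 j, inv_pos.2 hR0], by linarith [hw2 j]⟩
    nlinarith
  have hLl j : |L j - ℓ j| ≤ 2 * R ^ 3 * t ^ 2 := by
    have h1 := (abs_log_le_and_abs_log_sub_le hR (hw1 j)).2
    have h2 : w j ^ 2 ≤ (R * t) ^ 2 := by
      rw [← sq_abs]; exact pow_le_pow_left₀ (abs_nonneg _) (hw j) 2
    have h3 : |L j - ℓ j| ≤ |L j - w j| + |w j - ℓ j| := abs_sub_le _ _ _
    have h4 : R * w j ^ 2 ≤ R * (R * t) ^ 2 := mul_le_mul_of_nonneg_left h2 hR0.le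
    have h5 : R * t ^ 2 ≤ R ^ 3 * t ^ 2 := by
      have : R ≤ R ^ 3 := by nlinarith [mul_self_nonneg (R - 1)]
      exact mul_le_mul_of_nonneg_right this (sq_nonneg t)
    have := hwl j
    linarith
  have hl2 j : |ℓ j| ≤ R ^ 2 * t := (hl j).trans (by nlinarith [mul_nonneg hR0.le ht])
  have hexp j : L j ≤ w j - L j ^ 2 / 2 + R ^ 6 * Real.exp (R ^ 2) * t ^ 3 := by
    have h1 := abs_exp_sub_quadratic_le (L j)
    have h2 : Real.exp (L j) = 1 + w j :=
      Real.exp_log (lt_of_lt_of_le (inv_pos.2 hR0) (hw1 j))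
    have h3 : |L j| ^ 3 * Real.exp |L j| ≤ (R ^ 2 * t) ^ 3 * Real.exp (R ^ 2) := by
      gcongr
      · exact hLt j
      · exact hLR j
    rw [h2] at h1
    have := (abs_le.1 (h1.trans h3)).1
    linarith
  have hdiff j : ℓ j ^ 2 - L j ^ 2 ≤ 4 * R ^ 5 * t ^ 3 := by
    have h1 : |ℓ j + L j| ≤ 2 * R ^ 2 * t := by
      linarith [abs_add_le (ℓ j) (L j), hl2 j, hLt j]
    calc ℓ j ^ 2 - L j ^ 2 ≤ |(L j - ℓ j) * (ℓ j + L j)| := by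
          rw [← abs_neg]; exact (le_of_eq (by ring)).trans (le_abs_self _)
      _ ≤ (2 * R ^ 3 * t ^ 2) * (2 * R ^ 2 * t) := by
          rw [abs_mul]; gcongr; exact hLl j
      _ = _ := by ring
  have hΛ1 : |∑ j, c j * L j| ≤ S * (R ^ 2 * t) := abs_sum_mul_le _ hc hLt
  have hΛ2 : |∑ j, c j * L j| ≤ S * R ^ 2 := abs_sum_mul_le _ hc hLR
  have hΛ3 : |∑ j, c j * ℓ j| ≤ S * (R ^ 2 * t) := abs_sum_mul_le _ hc hl2
  have hΛ4 : |∑ j, c j * L j - ∑ j, c j * ℓ j| ≤ S * (2 * R ^ 3 * t ^ 2) := by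
    rw [← Finset.sum_sub_distrib]
    simp_rw [← mul_sub]
    exact abs_sum_mul_le _ hc hLl
  set Λ := ∑ j, c j * L j with hΛ
  set Λ' := ∑ j, c j * ℓ j with hΛ'
  have hsq : Λ ^ 2 - Λ' ^ 2 ≤ 4 * S ^ 2 * R ^ 5 * t ^ 3 := by
    have h1 : |Λ + Λ'| ≤ 2 * (S * (R ^ 2 * t)) := by linarith [abs_add_le Λ Λ']
    calc Λ ^ 2 - Λ' ^ 2 ≤ |(Λ - Λ') * (Λ + Λ')| := (le_of_eq (by ring)).trans (le_abs_self _)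
      _ ≤ (S * (2 * R ^ 3 * t ^ 2)) * (2 * (S * (R ^ 2 * t))) := by
          rw [abs_mul]; gcongr
      _ = _ := by ring
  have hexpΛ : Real.exp Λ ≤ 1 + Λ + Λ ^ 2 / 2 + (S * (R ^ 2 * t)) ^ 3 * Real.exp (S * R ^ 2) := by
    have h1 := abs_exp_sub_quadratic_le Λ
    have h3 : |Λ| ^ 3 * Real.exp |Λ| ≤ (S * (R ^ 2 * t)) ^ 3 * Real.exp (S * R ^ 2) := by
      gcongr
    linarith [(abs_le.1 (h1.trans h3)).2]
  have hsum : Λ ≤ ∑ j, c j * w j - (∑ j, c j * ℓ j ^ 2) / 2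
      + S * (R ^ 6 * Real.exp (R ^ 2) * t ^ 3 + 2 * R ^ 5 * t ^ 3) := by
    rw [hΛ, hS, Finset.sum_mul, Finset.sum_div, ← Finset.sum_sub_distrib, ← Finset.sum_add_distrib]
    refine Finset.sum_le_sum fun j _ => ?_
    have : L j ≤ w j - ℓ j ^ 2 / 2 + (R ^ 6 * Real.exp (R ^ 2) * t ^ 3 + 2 * R ^ 5 * t ^ 3) := by
      linarith [hexp j, hdiff j]
    calc c j * L j ≤ c j * _ := mul_le_mul_of_nonneg_left this (hc j)
      _ = _ := by ring
  linarith

lemma sub_one_le_mul_log {r : ℝ} (hr : 0 ≤ r) : r - 1 ≤ r * Real.log r := by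
  rcases hr.eq_or_lt with h0 | h0
  · rw [← h0]; simp
  · have h1 := mul_le_mul_of_nonneg_left (Real.one_sub_inv_le_log_of_pos h0) hr
    rwa [mul_sub, mul_one, mul_inv_cancel₀ h0.ne'] at h1

/-! ### Weighted geometric means -/

lemma prod_rpow_eq_exp {ι : Type*} [Fintype ι] (c u : ι → ℝ) (hu : ∀ j, 0 < u j) :
    ∏ j, u j ^ c j = Real.exp (∑ j, c j * Real.log (u j)) := by
  rw [Real.exp_sum]
  exact Finset.prod_congr rfl fun j _ => by rw [Real.rpow_def_of_pos (hu j), mul_comm]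

lemma continuous_prod_rpow {ι : Type*} [Fintype ι] (c : ι → ℝ) {T : Type*} [TopologicalSpace T]
    {F : ι → T → ℝ} (hF : ∀ j, Continuous (F j)) (hpos : ∀ j x, 0 < F j x) :
    Continuous fun x => ∏ j, F j x ^ c j :=
  continuous_finsetProd _ fun j _ => (hF j).rpow_const fun x => Or.inl (hpos j x).ne'

lemma norm_prod_rpow_le {ι : Type*} [Fintype ι] {c : ι → ℝ} (hc : ∀ j, 0 ≤ c j) {R : ℝ}
    {T : Type*} {F : ι → T → ℝ} (hpos : ∀ j x, 0 < F j x) (hle : ∀ j x, F j x ≤ R) (x : T) :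
    ‖∏ j, F j x ^ c j‖ ≤ ∏ j, R ^ c j := by
  rw [Real.norm_of_nonneg (Finset.prod_nonneg fun j _ => Real.rpow_nonneg (hpos j x).le _)]
  exact Finset.prod_le_prod (fun j _ => Real.rpow_nonneg (hpos j x).le _)
    fun j _ => Real.rpow_le_rpow (hpos j x).le (hle j x) (hc j)

/-! ### Functions with a quadratic first-order Taylor error -/

section QuadRegular

variable {E : Type*} [NormedAddCommGroup E] [InnerProductSpace ℝ E]

/-- `F` takes values in `[R⁻¹, R]` and has a continuous gradient field `G` bounded by `R`, with
first-order Taylor error at most `R ‖h‖²`. The gradient is carried as data and only through the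
Taylor estimate, so that the class is visibly stable under averages of translates. -/
structure QuadRegular (R : ℝ) (F : E → ℝ) (G : E → E) : Prop where
  continuous : Continuous F
  continuous_grad : Continuous G
  inv_le : ∀ x, R⁻¹ ≤ F x
  le : ∀ x, F x ≤ R
  norm_grad_le : ∀ x, ‖G x‖ ≤ R
  taylor : ∀ x h, |F (x + h) - F x - ⟪G x, h⟫| ≤ R * ‖h‖ ^ 2

namespace QuadRegular

variable {R : ℝ} {F : E → ℝ} {G : E → E}

lemma pos_apply (h : QuadRegular R F G) (hR : 1 ≤ R) (x : E) : 0 < F x :=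
  (inv_pos.2 (zero_lt_one.trans_le hR)).trans_le (h.inv_le x)

lemma norm_le (h : QuadRegular R F G) (hR : 1 ≤ R) (x : E) : ‖F x‖ ≤ R := by
  rw [Real.norm_of_nonneg (h.pos_apply hR x).le]; exact h.le x

end QuadRegular

end QuadRegular

/-! ### The heat semigroup -/

section Heat

variable {E : Type*} [NormedAddCommGroup E] [InnerProductSpace ℝ E] [FiniteDimensional ℝ E]
  [MeasurableSpace E] [BorelSpace E]

lemma integrable_comp_add_smul {X : Type*} [NormedAddCommGroup X]
    [SecondCountableTopology X] {F : E → X} (hF : Continuous F)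
    {B : ℝ} (hB : ∀ x, ‖F x‖ ≤ B) (s : ℝ) (x : E) :
    Integrable (fun y => F (x + √s • y)) (stdGaussian E) :=
  Integrable.of_bound (by fun_prop) B (ae_of_all _ fun _ => hB _)

variable {X : Type*} [NormedAddCommGroup X] [NormedSpace ℝ X]

/-- The heat semigroup `heat s F x = 𝔼 F(x + √s Y)`, `Y` a standard Gaussian vector. -/
noncomputable def heat (s : ℝ) (F : E → X) (x : E) : X :=
  ∫ y, F (x + √s • y) ∂(stdGaussian E)

lemma continuous_heat [SecondCountableTopology X] {F : E → X} (hF : Continuous F)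
    {B : ℝ} (hB : ∀ x, ‖F x‖ ≤ B) (s : ℝ) : Continuous (heat s F) := by
  refine continuous_of_dominated (bound := fun _ => B) (fun x => by fun_prop)
    (fun x => ae_of_all _ fun _ => hB _) (integrable_const _) (ae_of_all _ fun y => by fun_prop)

lemma norm_heat_le {F : E → X} {B : ℝ} (hB : ∀ x, ‖F x‖ ≤ B) (s : ℝ) (x : E) :
    ‖heat s F x‖ ≤ B := by
  simpa [heat] using norm_integral_le_of_norm_le_const (μ := stdGaussian E)
    (ae_of_all _ fun y => hB (x + √s • y))

lemma heat_zero (F : E → ℝ) : heat 0 F = F := by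
  ext x; simp [heat]

lemma heat_heat {F : E → ℝ} (hF : Continuous F) {B : ℝ} (hB : ∀ x, ‖F x‖ ≤ B)
    {s t : ℝ} (hs : 0 ≤ s) (ht : 0 ≤ t) : heat s (heat t F) = heat (s + t) F := by
  ext x
  have hm : Measurable (fun q : E × E => √s • q.1 + √t • q.2) := by fun_prop
  have h1 : heat (s + t) F x = ∫ z, F (x + z) ∂((stdGaussian E).map (fun y => √(s + t) • y)) := by
    rw [integral_map (by fun_prop) (by fun_prop), heat]
  rw [h1, ← map_prod_smul_add_stdGaussian hs ht, integral_map hm.aemeasurable (by fun_prop),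
    integral_prod]
  · simp only [heat, add_assoc]
  · exact Integrable.of_bound (by fun_prop) B (ae_of_all _ fun _ => hB _)

lemma heat_mono {F H : E → ℝ} (hF : Continuous F) (hH : Continuous H) {B B' : ℝ}
    (hB : ∀ x, ‖F x‖ ≤ B) (hB' : ∀ x, ‖H x‖ ≤ B') (h : ∀ x, F x ≤ H x) (s : ℝ) (x : E) :
    heat s F x ≤ heat s H x :=
  integral_mono (integrable_comp_add_smul hF hB s x) (integrable_comp_add_smul hH hB' s x)
    fun _ => h _

namespace QuadRegular

variable {R : ℝ} {F : E → ℝ} {G : E → E}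

lemma integrable (h : QuadRegular R F G) (hR : 1 ≤ R) (s : ℝ) (x : E) :
    Integrable (fun y => F (x + √s • y)) (stdGaussian E) :=
  integrable_comp_add_smul h.continuous (h.norm_le hR) s x

protected lemma heat (h : QuadRegular R F G) (hR : 1 ≤ R) (s : ℝ) :
    QuadRegular R (heat s F) (heat s G) where
  continuous := continuous_heat h.continuous (h.norm_le hR) s
  continuous_grad := continuous_heat h.continuous_grad h.norm_grad_le s
  inv_le x := by
    simpa [heat] using integral_mono (integrable_const (R⁻¹)) (h.integrable hR s x)
      fun y => h.inv_le _
  le x := by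
    simpa [heat] using integral_mono (h.integrable hR s x) (integrable_const R) fun y => h.le _
  norm_grad_le x := norm_heat_le h.norm_grad_le s x
  taylor x u := by
    have hG := integrable_comp_add_smul h.continuous_grad h.norm_grad_le s x
    have h1 : heat s F (x + u) - heat s F x - ⟪heat s G x, u⟫ =
        ∫ y, (F (x + √s • y + u) - F (x + √s • y) - ⟪G (x + √s • y), u⟫) ∂(stdGaussian E) := by
      have h2 : Integrable (fun y => F (x + √s • y + u)) (stdGaussian E) := by
        simpa only [add_right_comm] using h.integrable hR s (x + u)
      have h3 : Integrable (fun y => F (x + √s • y + u) - F (x + √s • y)) (stdGaussian E) :=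
        h2.sub (h.integrable hR s x)
      rw [integral_sub h3 (hG.inner_const u), integral_sub h2 (h.integrable hR s x)]
      simp only [heat, add_right_comm x u]
      congr 1
      rw [real_inner_comm, ← integral_inner hG]
      simp_rw [real_inner_comm u]
    rw [h1]
    simpa using norm_integral_le_of_norm_le_const (μ := stdGaussian E)
      (ae_of_all _ fun y => (Real.norm_eq_abs _).trans_le (h.taylor (x + √s • y) u))

/-- The Gaussian increment of `F` about its heat average is linear up to an error of order `s`. -/
lemma abs_sub_heat_sub_le (h : QuadRegular R F G) (hR : 1 ≤ R) {s : ℝ} (hs : 0 ≤ s) (x y : E) :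
    |F (x + √s • y) - heat s F x - √s * ⟪G x, y⟫| ≤
      R * s * (‖y‖ ^ 2 + ∫ z : E, ‖z‖ ^ 2 ∂(stdGaussian E)) := by
  have hT (z : E) : |F (x + √s • z) - F x - √s * ⟪G x, z⟫| ≤ R * s * ‖z‖ ^ 2 := by
    have := h.taylor x (√s • z)
    rw [inner_smul_right, norm_smul, mul_pow, Real.norm_of_nonneg (Real.sqrt_nonneg _),
      Real.sq_sqrt hs] at this
    linarith
  have hi : Integrable (fun z => √s * ⟪G x, z⟫) (stdGaussian E) :=
    (IsGaussian.integrable_id.const_inner (G x)).const_mul _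
  have h0 : heat s F x - F x = ∫ z, (F (x + √s • z) - F x - √s * ⟪G x, z⟫) ∂(stdGaussian E) := by
    have h3 : Integrable (fun z => F (x + √s • z) - F x) (stdGaussian E) :=
      (h.integrable hR s x).sub (integrable_const _)
    rw [integral_sub h3 hi, integral_sub (h.integrable hR s x) (integrable_const _),
      integral_const_mul, integral_inner_stdGaussian]
    simp [heat]
  have h1 : |heat s F x - F x| ≤ R * s * ∫ z : E, ‖z‖ ^ 2 ∂(stdGaussian E) := by
    rw [h0, ← integral_const_mul]
    exact norm_integral_le_of_norm_le ((integrable_norm_pow_stdGaussian 2).const_mul _)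
      (ae_of_all _ fun z => (Real.norm_eq_abs _).trans_le (hT z))
  have h2 := hT y
  rw [abs_le] at *
  constructor <;> linarith

end QuadRegular

/-- The infinitesimal form of the Brascamp–Lieb inequality: for a heat step of length `s` it holds
up to a relative error `O(s^{3/2})`, uniformly over `QuadRegular R` functions. The first-order terms
have mean zero, and the mean of the second-order term is `‖∑ c_j v_j‖² - ∑ c_j ‖v_j‖² ≤ 0` for
vectors `v_j ∈ V_j` proportional to the gradients. -/
lemma exists_heat_prod_rpow_le {ι : Type*} [Fintype ι] {c : ι → ℝ} (hc : ∀ j, 0 ≤ c j)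
    {V : ι → Submodule ℝ E}
    (hV : ∀ v : ι → E, (∀ j, v j ∈ V j) → ‖∑ j, c j • v j‖ ^ 2 ≤ ∑ j, c j * ‖v j‖ ^ 2)
    {R : ℝ} (hR : 1 ≤ R) :
    ∃ C : ℝ, 0 ≤ C ∧ ∀ (F : ι → E → ℝ) (G : ι → E → E), (∀ j, QuadRegular R (F j) (G j)) →
      (∀ j x, G j x ∈ V j) → ∀ s : ℝ, 0 ≤ s → s ≤ 1 → ∀ x,
      heat s (fun x => ∏ j, F j x ^ c j) x ≤ (1 + C * √s ^ 3) * ∏ j, heat s (F j) x ^ c j := by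
  have hR0 : 0 < R := by linarith
  set m := ∫ z : E, ‖z‖ ^ 2 ∂(stdGaussian E) with hm
  have hm0 : 0 ≤ m := integral_nonneg fun z => by positivity
  -- A common bound for the increments, their linear parts and the errors, relative to the average.
  set R' := R ^ 2 * (2 + m) with hR'
  have hR2 : 1 ≤ R ^ 2 := one_le_pow₀ hR
  have hR'1 : 1 ≤ R' := by nlinarith
  have hR2R' : R ^ 2 ≤ R' := by nlinarith
  obtain ⟨C, hC0, hC⟩ := exists_exp_sum_log_le hc hR'1
  set I := ∫ z : E, (1 + ‖z‖ ^ 2) ^ 3 ∂(stdGaussian E) with hI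
  have hDint : Integrable (fun z : E => (1 + ‖z‖ ^ 2) ^ 3) (stdGaussian E) := by
    have : (fun z : E => (1 + ‖z‖ ^ 2) ^ 3) =
        fun z => 1 + 3 * ‖z‖ ^ 2 + 3 * ‖z‖ ^ 4 + ‖z‖ ^ 6 := by ext z; ring
    rw [this]
    exact (((integrable_const _).add ((integrable_norm_pow_stdGaussian 2).const_mul 3)).add
      ((integrable_norm_pow_stdGaussian 4).const_mul 3)).add (integrable_norm_pow_stdGaussian 6)
  refine ⟨C * I, mul_nonneg hC0 (integral_nonneg fun z => by positivity), ?_⟩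
  intro F G hFG hGV s hs hs1 x
  set δ := √s with hδ
  have hδ0 : 0 ≤ δ := Real.sqrt_nonneg s
  have hδ1 : δ ≤ 1 := Real.sqrt_le_one.2 hs1
  have hδs : δ ^ 2 = s := Real.sq_sqrt hs
  set A : ι → ℝ := fun j => heat s (F j) x with hA
  have hA0 j : 0 < A j := ((hFG j).heat hR s).pos_apply hR x
  have hAR j : A j ≤ R := ((hFG j).heat hR s).le x
  have hAR' j : (A j)⁻¹ ≤ R := inv_le_of_inv_le₀ hR0 (((hFG j).heat hR s).inv_le x)
  set v : ι → E := fun j => (A j)⁻¹ • G j x with hv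
  have hvR j : ‖v j‖ ≤ R ^ 2 := by
    rw [norm_smul, norm_inv, Real.norm_of_nonneg (hA0 j).le, sq]
    exact mul_le_mul (hAR' j) ((hFG j).norm_grad_le x) (norm_nonneg _) hR0.le
  have hvV := hV v fun j => (V j).smul_mem _ (hGV j x)
  set w : ι → E → ℝ := fun j y => F j (x + δ • y) * (A j)⁻¹ - 1 with hw
  have hint j : Integrable (fun y => F j (x + δ • y)) (stdGaussian E) := (hFG j).integrable hR s x
  have hwint j : Integrable (w j) (stdGaussian E) :=
    ((hint j).mul_const _).sub (integrable_const _)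
  have hw0 j : ∫ y, w j y ∂(stdGaussian E) = 0 := by
    rw [integral_sub ((hint j).mul_const _) (integrable_const _), integral_mul_const]
    have : ∫ y, F j (x + δ • y) ∂(stdGaussian E) = A j := rfl
    rw [this, mul_inv_cancel₀ (hA0 j).ne']; simp
  have hFpos j y : 0 < F j y := (hFG j).pos_apply hR y
  have hpt (y : E) : ∏ j, F j (x + δ • y) ^ c j ≤ (∏ j, A j ^ c j) *
      (1 + ∑ j, c j * w j y
        + ((∑ j, c j * (δ * ⟪v j, y⟫)) ^ 2 - ∑ j, c j * (δ * ⟪v j, y⟫) ^ 2) / 2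
        + C * (δ * (1 + ‖y‖ ^ 2)) ^ 3) := by
    have hwl j : |w j y - δ * ⟪v j, y⟫| ≤ R ^ 2 * (1 + m) * (δ ^ 2 * (1 + ‖y‖ ^ 2)) := by
      have h1 := (hFG j).abs_sub_heat_sub_le hR hs x y
      have h2 : w j y - δ * ⟪v j, y⟫ =
          (A j)⁻¹ * (F j (x + δ • y) - heat s (F j) x - δ * ⟪G j x, y⟫) := by
        have h3 : (A j)⁻¹ * heat s (F j) x = 1 := inv_mul_cancel₀ (hA0 j).ne'
        simp only [hw, hv, real_inner_smul_left]
        linear_combination h3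
      rw [h2, abs_mul, abs_of_pos (inv_pos.2 (hA0 j))]
      calc (A j)⁻¹ * _ ≤ R * (R * s * (‖y‖ ^ 2 + m)) :=
            mul_le_mul (hAR' j) h1 (abs_nonneg _) hR0.le
        _ = R ^ 2 * δ ^ 2 * (‖y‖ ^ 2 + m) := by rw [hδs]; ring
        _ ≤ R ^ 2 * δ ^ 2 * ((1 + m) * (1 + ‖y‖ ^ 2)) := by
            gcongr
            nlinarith [mul_nonneg hm0 (sq_nonneg ‖y‖)]
        _ = _ := by ring
    have hy : ‖y‖ ≤ 1 + ‖y‖ ^ 2 := by nlinarith [sq_nonneg (‖y‖ - 1)]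
    have hl j : |δ * ⟪v j, y⟫| ≤ R ^ 2 * (δ * (1 + ‖y‖ ^ 2)) := by
      rw [abs_mul, abs_of_nonneg hδ0]
      calc δ * |⟪v j, y⟫| ≤ δ * (R ^ 2 * (1 + ‖y‖ ^ 2)) := by
            gcongr
            exact (abs_real_inner_le_norm _ _).trans
              (mul_le_mul (hvR j) hy (norm_nonneg _) (by positivity))
        _ = _ := by ring
    have hdd : δ ^ 2 ≤ δ := by nlinarith
    -- Since `‖y‖ ≤ 1 + ‖y‖²` and `δ ≤ 1`, the scale `t = δ (1 + ‖y‖²)` controls the linear part by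
    -- `t` and the error by `t²`.
    have key := hC (δ * (1 + ‖y‖ ^ 2)) (fun j => δ * ⟪v j, y⟫) (fun j => w j y) (by positivity)
      (fun j => ?_) (fun j => ?_) (fun j => ?_) (fun j => ?_) (fun j => ?_)
    · rw [prod_rpow_eq_exp c A hA0]
      have hprod : ∏ j, F j (x + δ • y) ^ c j =
          Real.exp (∑ j, c j * Real.log (A j)) *
          Real.exp (∑ j, c j * Real.log (1 + w j y)) := by
        rw [prod_rpow_eq_exp c _ fun j => hFpos j _, ← Real.exp_add, ← Finset.sum_add_distrib]
        congr 1
        refine Finset.sum_congr rfl fun j _ => ?_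
        rw [← mul_add, ← Real.log_mul (hA0 j).ne']
        · congr 2
          simp only [hw]
          field_simp [(hA0 j).ne']
          ring
        · simp only [hw, add_sub_cancel]
          exact (mul_pos (hFpos j _) (inv_pos.2 (hA0 j))).ne'
      rw [hprod]
      exact mul_le_mul_of_nonneg_left key (Real.exp_pos _).le
    · simp only [hw, add_sub_cancel]
      calc R'⁻¹ ≤ (R ^ 2)⁻¹ := inv_anti₀ (by positivity) hR2R'
        _ = R⁻¹ * R⁻¹ := by rw [sq, mul_inv]
        _ ≤ _ := mul_le_mul ((hFG j).inv_le _) (inv_anti₀ (hA0 j) (hAR j)) (by positivity)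
            (hFpos j _).le
    · simp only [hw, add_sub_cancel]
      calc _ ≤ R * R := mul_le_mul ((hFG j).le _) (hAR' j) (inv_pos.2 (hA0 j)).le hR0.le
        _ ≤ R' := by rw [← sq]; exact hR2R'
    · exact (hl j).trans (mul_le_mul_of_nonneg_right hR2R' (by positivity))
    · have h1 := abs_sub_abs_le_abs_sub (w j y) (δ * ⟪v j, y⟫)
      have h2 : R ^ 2 * (1 + m) * (δ ^ 2 * (1 + ‖y‖ ^ 2)) ≤
        R ^ 2 * (1 + m) * (δ * (1 + ‖y‖ ^ 2)) := by gcongr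
      have := hwl j
      have := hl j
      simp only [hR']
      linarith
    · refine (hwl j).trans ?_
      rw [mul_pow]
      have : 1 + ‖y‖ ^ 2 ≤ (1 + ‖y‖ ^ 2) ^ 2 := by nlinarith [sq_nonneg ‖y‖]
      have : 1 + m ≤ 2 + m := by linarith
      simp only [hR']
      gcongr
  have hsqint (u : E) : Integrable (fun y => ⟪u, y⟫ ^ 2) (stdGaussian E) :=
    (IsGaussian.memLp_two_id.const_inner u).integrable_sq
  set Q : E → ℝ := fun y => ⟪∑ j, c j • v j, y⟫ ^ 2 - ∑ j, c j * ⟪v j, y⟫ ^ 2 with hQ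
  have hQint : Integrable Q (stdGaussian E) :=
    (hsqint _).sub (integrable_finsetSum _ fun j _ => (hsqint _).const_mul _)
  have hQ0 : ∫ y, Q y ∂(stdGaussian E) ≤ 0 := by
    rw [integral_sub (hsqint _) (integrable_finsetSum _ fun j _ => (hsqint _).const_mul _),
      integral_finsetSum _ fun j _ => (hsqint _).const_mul _]
    simp_rw [integral_const_mul, integral_inner_sq_stdGaussian]
    linarith
  have hpt' (y : E) : ∏ j, F j (x + δ • y) ^ c j ≤ (∏ j, A j ^ c j) *
      (1 + ∑ j, c j * w j y + δ ^ 2 / 2 * Q y + C * δ ^ 3 * (1 + ‖y‖ ^ 2) ^ 3) := by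
    refine (hpt y).trans (le_of_eq ?_)
    have h1 : ∑ j, c j * (δ * ⟪v j, y⟫) = δ * ⟪∑ j, c j • v j, y⟫ := by
      rw [sum_inner, Finset.mul_sum]
      exact Finset.sum_congr rfl fun j _ => by
        rw [real_inner_smul_left (v j) y (c j)]; ring
    have h2 : ∑ j, c j * (δ * ⟪v j, y⟫) ^ 2 = δ ^ 2 * ∑ j, c j * ⟪v j, y⟫ ^ 2 := by
      rw [Finset.mul_sum]
      exact Finset.sum_congr rfl fun j _ => by ring
    rw [h1, h2]
    simp only [hQ]
    ring
  have hwsum : Integrable (fun y => ∑ j, c j * w j y) (stdGaussian E) :=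
    integrable_finsetSum _ fun j _ => (hwint j).const_mul _
  have hint1 : Integrable (fun y => 1 + ∑ j, c j * w j y) (stdGaussian E) :=
    (integrable_const _).add hwsum
  have hint2 : Integrable (fun y => 1 + ∑ j, c j * w j y + δ ^ 2 / 2 * Q y) (stdGaussian E) :=
    hint1.add (hQint.const_mul _)
  have hint3 := hDint.const_mul (C * δ ^ 3)
  have hmono := integral_mono (integrable_comp_add_smul
    (continuous_prod_rpow c (fun j => (hFG j).continuous) hFpos)
    (norm_prod_rpow_le hc hFpos fun j => (hFG j).le) s x) ((hint2.add hint3).const_mul _) hpt'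
  have hval : ∫ y, (1 + ∑ j, c j * w j y + δ ^ 2 / 2 * Q y + C * δ ^ 3 * (1 + ‖y‖ ^ 2) ^ 3)
      ∂(stdGaussian E) = 1 + δ ^ 2 / 2 * ∫ y, Q y ∂(stdGaussian E) + C * δ ^ 3 * I := by
    rw [integral_add hint2 hint3, integral_add hint1 (hQint.const_mul _),
      integral_add (integrable_const _) hwsum, integral_const_mul, integral_const_mul,
      integral_finsetSum _ fun j _ => (hwint j).const_mul _]
    simp_rw [integral_const_mul, hw0]
    simp [hI]
  have hP0 : 0 ≤ ∏ j, A j ^ c j := Finset.prod_nonneg fun j _ => Real.rpow_nonneg (hA0 j).le _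
  calc _ ≤ _ := hmono
    _ = (∏ j, A j ^ c j) * (1 + δ ^ 2 / 2 * ∫ y, Q y ∂(stdGaussian E) + C * δ ^ 3 * I) := by
        rw [← hval, ← integral_const_mul]; rfl
    _ ≤ (∏ j, A j ^ c j) * (1 + C * I * δ ^ 3) := by
        refine mul_le_mul_of_nonneg_left ?_ hP0
        have := mul_nonpos_of_nonneg_of_nonpos (by positivity : 0 ≤ δ ^ 2 / 2) hQ0
        linarith
    _ = _ := mul_comm _ _

lemma heat_mem {V : Submodule ℝ E} {G : E → E} (hG : Continuous G) {B : ℝ} (hB : ∀ x, ‖G x‖ ≤ B)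
    (hV : ∀ x, G x ∈ V) (s : ℝ) (x : E) : heat s G x ∈ V := by
  have h : V.starProjection (heat s G x) = heat s G x := by
    rw [heat, ← ContinuousLinearMap.integral_comp_comm _ (integrable_comp_add_smul hG hB s x)]
    exact integral_congr_ae (ae_of_all _ fun y => Submodule.starProjection_eq_self_iff.2 (hV _))
  exact Submodule.starProjection_eq_self_iff.1 h

/-- The Brascamp–Lieb inequality for regular functions. Splitting the unit of time into `m` heat
steps costs a total factor `(1 + C m^{-3/2})^m ≤ exp (C / √m)`, which tends to `1`. -/
theorem integral_prod_rpow_le_of_quadRegular {ι : Type*} [Fintype ι] {c : ι → ℝ}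
    (hc : ∀ j, 0 ≤ c j) {V : ι → Submodule ℝ E}
    (hV : ∀ v : ι → E, (∀ j, v j ∈ V j) → ‖∑ j, c j • v j‖ ^ 2 ≤ ∑ j, c j * ‖v j‖ ^ 2)
    {R : ℝ} (hR : 1 ≤ R) {F : ι → E → ℝ} {G : ι → E → E} (hFG : ∀ j, QuadRegular R (F j) (G j))
    (hGV : ∀ j x, G j x ∈ V j) :
    ∫ x, ∏ j, F j x ^ c j ∂(stdGaussian E) ≤ ∏ j, (∫ x, F j x ∂(stdGaussian E)) ^ c j := by
  obtain ⟨C, hC0, hC⟩ := exists_heat_prod_rpow_le hc hV hR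
  -- Each step replaces the functions `F j` by their heat averages, which are in the same class.
  have iter (s : ℝ) (hs : 0 ≤ s) (hs1 : s ≤ 1) (m : ℕ) : ∀ (F : ι → E → ℝ) (G : ι → E → E),
      (∀ j, QuadRegular R (F j) (G j)) → (∀ j x, G j x ∈ V j) → ∀ x,
      heat (m * s) (fun x => ∏ j, F j x ^ c j) x ≤
        (1 + C * √s ^ 3) ^ m * ∏ j, heat (m * s) (F j) x ^ c j := by
    induction m with
    | zero => intro F G _ _ x; simp [heat_zero]
    | succ m ih =>
      intro F G hFG hGV x
      have hFG' j := (hFG j).heat hR s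
      have hpos j x := (hFG j).pos_apply hR x
      have hpos' j x := (hFG' j).pos_apply hR x
      have hcont := continuous_prod_rpow c (fun j => (hFG j).continuous) hpos
      have hcont' := continuous_prod_rpow c (fun j => (hFG' j).continuous) hpos'
      have hbd := norm_prod_rpow_le hc hpos fun j => (hFG j).le
      have hbd' := norm_prod_rpow_le hc hpos' fun j => (hFG' j).le
      have hms : 0 ≤ m * s := by positivity
      have hcast : ((m + 1 : ℕ) : ℝ) * s = m * s + s := by push_cast; ring
      have hC1 : 0 ≤ 1 + C * √s ^ 3 := by positivity
      have e1 : heat (m * s) (fun x => (1 + C * √s ^ 3) * ∏ j, heat s (F j) x ^ c j) x =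
          (1 + C * √s ^ 3) * heat (m * s) (fun x => ∏ j, heat s (F j) x ^ c j) x :=
        integral_const_mul _ _
      have e2 j : heat (m * s) (heat s (F j)) = heat (m * s + s) (F j) :=
        heat_heat (hFG j).continuous ((hFG j).norm_le hR) hms hs
      have ih' := ih _ _ hFG' (fun j x =>
        heat_mem (hFG j).continuous_grad (hFG j).norm_grad_le (hGV j) s x) x
      simp_rw [e2] at ih'
      rw [hcast, ← heat_heat hcont hbd hms hs]
      calc _ ≤ heat (m * s) (fun x => (1 + C * √s ^ 3) * ∏ j, heat s (F j) x ^ c j) x :=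
            heat_mono (continuous_heat hcont hbd s) (continuous_const.mul hcont')
            (norm_heat_le hbd s) (B' := (1 + C * √s ^ 3) * ∏ j, R ^ c j) (fun x => by
              rw [Pi.mul_apply, norm_mul, Real.norm_of_nonneg hC1]
              exact mul_le_mul_of_nonneg_left (hbd' x) hC1) (hC F G hFG hGV s hs hs1) _ x
        _ ≤ _ := by
            rw [e1, pow_succ' (1 + C * √s ^ 3), mul_assoc]
            exact mul_le_mul_of_nonneg_left ih' hC1
  have e1 (H : E → ℝ) : heat 1 H 0 = ∫ x, H x ∂(stdGaussian E) := by simp [heat]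
  have hP0 : 0 ≤ ∏ j, heat 1 (F j) 0 ^ c j := Finset.prod_nonneg fun j _ =>
    Real.rpow_nonneg (((hFG j).heat hR 1).pos_apply hR 0).le _
  have hbound (m : ℕ) : heat 1 (fun x => ∏ j, F j x ^ c j) 0 ≤
      Real.exp (C * √(1 / ((m : ℝ) + 1))) * ∏ j, heat 1 (F j) 0 ^ c j := by
    have hm : (0 : ℝ) < (m : ℝ) + 1 := by positivity
    have hs : 0 ≤ 1 / ((m : ℝ) + 1) := by positivity
    have h := iter (1 / ((m : ℝ) + 1)) hs
      (by rw [div_le_one hm]; linarith [Nat.cast_nonneg (α := ℝ) m]) (m + 1) F G hFG hGV 0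
    have hone : ((m + 1 : ℕ) : ℝ) * (1 / ((m : ℝ) + 1)) = 1 := by push_cast; field_simp
    rw [hone] at h
    refine h.trans (mul_le_mul_of_nonneg_right ?_ hP0)
    set δ := √(1 / ((m : ℝ) + 1)) with hδ
    have h2 : ((m + 1 : ℕ) : ℝ) * δ ^ 2 = 1 := by rw [hδ, Real.sq_sqrt hs, hone]
    have h3 : 1 + C * δ ^ 3 ≤ Real.exp (C * δ ^ 3) := by linarith [Real.add_one_le_exp (C * δ ^ 3)]
    calc (1 + C * δ ^ 3) ^ (m + 1) ≤ Real.exp (C * δ ^ 3) ^ (m + 1) :=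
          pow_le_pow_left₀ (by positivity) h3 _
      _ = Real.exp (C * δ) := by
          rw [← Real.exp_nat_mul]
          congr 1
          linear_combination C * δ * h2
  have hlim : Filter.Tendsto (fun m : ℕ => Real.exp (C * √(1 / ((m : ℝ) + 1))) *
      ∏ j, heat 1 (F j) 0 ^ c j) Filter.atTop (nhds (∏ j, heat 1 (F j) 0 ^ c j)) := by
    have h1 := (Real.continuous_sqrt.tendsto _).comp
      (tendsto_one_div_add_atTop_nhds_zero_nat (𝕜 := ℝ))
    have h2 := ((Real.continuous_exp.tendsto _).comp (h1.const_mul C)).mul_const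
      (∏ j, heat 1 (F j) 0 ^ c j)
    simpa using h2
  have := ge_of_tendsto' hlim hbound
  simpa only [e1] using this

end Heat

/-! ### Test functions -/

section TestFunctions

variable {E : Type*} [NormedAddCommGroup E] [InnerProductSpace ℝ E]

lemma orthogonalProjectionOnto_add_orthogonal (V : Submodule ℝ E)
    [V.HasOrthogonalProjection] (y : V) (z : Vᗮ) :
    V.orthogonalProjectionOnto ((y : E) + z) = y := by
  rw [map_add, Submodule.orthogonalProjectionOnto_mem_subspace_eq_self,
    Submodule.orthogonalProjectionOnto_apply_of_mem_orthogonal z.2, add_zero]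

lemma QuadRegular.comp_orthogonalProjectionOnto {V : Submodule ℝ E}
    [V.HasOrthogonalProjection] {R : ℝ} (hR : 0 ≤ R)
    {f : V → ℝ} {G : V → V} (h : QuadRegular R f G) :
    QuadRegular R (fun x => f (V.orthogonalProjectionOnto x))
      (fun x => (G (V.orthogonalProjectionOnto x) : E)) where
  continuous := h.continuous.comp (by fun_prop)
  continuous_grad := continuous_subtype_val.comp (h.continuous_grad.comp (by fun_prop))
  inv_le x := h.inv_le _
  le x := h.le _
  norm_grad_le x := h.norm_grad_le _
  taylor x u := by
    rw [map_add, ← Submodule.inner_orthogonalProjectionOnto_eq_of_mem_left]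
    refine (h.taylor _ _).trans ?_
    gcongr
    exact Submodule.norm_orthogonalProjectionOnto_apply_le V u

/-- Compactly supported functions `φ` give test functions `exp (B arctan φ)` bounded away from `0`
and `∞`, with compactly supported gradient. -/
lemma exists_quadRegular_exp_arctan [FiniteDimensional ℝ E] {φ : E → ℝ} (hφ : ContDiff ℝ 2 φ)
    (hsupp : HasCompactSupport φ) (B : ℝ) :
    ∃ R₀ : ℝ, ∀ R ≥ R₀, ∃ G : E → E,
      QuadRegular R (fun x => Real.exp (B * Real.arctan (φ x))) G := by
  have hf : ContDiff ℝ 2 fun x => Real.exp (B * Real.arctan (φ x)) :=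
    (contDiff_const.mul (Real.contDiff_arctan.comp hφ)).exp
  set f := fun x => Real.exp (B * Real.arctan (φ x)) with hfdef
  have hf' : ContDiff ℝ 1 (fderiv ℝ f) := hf.fderiv_right (by norm_num)
  -- `f` itself is `1`, not `0`, off the support of `φ`.
  have hs : HasCompactSupport (fderiv ℝ f) := by
    have h1 : HasCompactSupport fun x => f x - 1 :=
      hsupp.comp_left (g := fun t => Real.exp (B * Real.arctan t) - 1) (by simp)
    have h2 : fderiv ℝ (fun x => f x - 1) = fderiv ℝ f := funext fun x => fderiv_sub_const _
    exact h2 ▸ h1.fderiv ℝ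
  obtain ⟨K, hK⟩ := hf'.lipschitzWith_of_hasCompactSupport hs (by norm_num)
  obtain ⟨M, hM⟩ := hs.exists_bound_of_continuous hf'.continuous
  refine ⟨max (max K M) (Real.exp (|B| * (Real.pi / 2))), fun R hR => ?_⟩
  have hRK : (K : ℝ) ≤ R := (le_max_left _ _).trans ((le_max_left _ _).trans hR)
  have hRM : M ≤ R := (le_max_right _ _).trans ((le_max_left _ _).trans hR)
  have hRB : Real.exp (|B| * (Real.pi / 2)) ≤ R := (le_max_right _ _).trans hR
  have hBb (x : E) : |B * Real.arctan (φ x)| ≤ |B| * (Real.pi / 2) := by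
    rw [abs_mul]
    exact mul_le_mul_of_nonneg_left (abs_le.2 ⟨(Real.neg_pi_div_two_lt_arctan _).le,
      (Real.arctan_lt_pi_div_two _).le⟩) (abs_nonneg B)
  refine ⟨fun x => (InnerProductSpace.toDual ℝ E).symm (fderiv ℝ f x), ?_, ?_, ?_, ?_, ?_, ?_⟩
  · exact hf.continuous
  · exact (InnerProductSpace.toDual ℝ E).symm.continuous.comp hf'.continuous
  · intro x
    calc R⁻¹ ≤ (Real.exp (|B| * (Real.pi / 2)))⁻¹ := inv_anti₀ (Real.exp_pos _) hRB
      _ ≤ _ := by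
        rw [← Real.exp_neg]
        exact Real.exp_le_exp.2 (neg_le_of_abs_le (hBb x))
  · intro x
    exact (Real.exp_le_exp.2 ((le_abs_self _).trans (hBb x))).trans hRB
  · intro x
    rw [LinearIsometryEquiv.norm_map]
    exact (hM x).trans hRM
  · intro x h
    rw [InnerProductSpace.toDual_symm_apply]
    have hconv := (convex_closedBall x ‖h‖).norm_image_sub_le_of_norm_fderiv_le' (𝕜 := ℝ)
      (f := f) (φ := fderiv ℝ f x) (C := K * ‖h‖) (x := x) (y := x + h)
      (fun y _ => (hf.differentiable (by norm_num)) y) (fun y hy => ?_) (by simp) (by simp)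
    · rw [add_sub_cancel_left, Real.norm_eq_abs] at hconv
      refine hconv.trans ?_
      rw [mul_assoc, ← sq]
      exact mul_le_mul_of_nonneg_right hRK (sq_nonneg _)
    · refine (hK.norm_sub_le y x).trans ?_
      gcongr
      simpa [dist_eq_norm] using hy

end TestFunctions

/-! ### Marginals and Gibbs' variational inequality -/

section Densities

variable {E : Type*} [NormedAddCommGroup E] [InnerProductSpace ℝ E] [FiniteDimensional ℝ E]
  [MeasurableSpace E] {ρ : E → ℝ}

lemma IsGaussDensity.integrable (hρ : IsGaussDensity ρ) : Integrable ρ (stdGaussian E) := by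
  by_contra h
  have := hρ.integral_eq_one
  rw [integral_undef h] at this
  exact zero_ne_one this

lemma IsGaussDensity.integrable_mul_bdd (hρ : IsGaussDensity ρ) {g : E → ℝ}
    (hg : AEStronglyMeasurable g (stdGaussian E)) {B : ℝ} (hB : ∀ x, |g x| ≤ B) :
    Integrable (fun x => ρ x * g x) (stdGaussian E) :=
  hρ.integrable.mul_bdd hg (ae_of_all _ hB)

end Densities

section Marginals

variable {E : Type*} [NormedAddCommGroup E] [InnerProductSpace ℝ E] [FiniteDimensional ℝ E]
  [MeasurableSpace E] [BorelSpace E]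

lemma integrable_comp_add_prod (V : Submodule ℝ E) {F : E → ℝ}
    (hF : Integrable F (stdGaussian E)) :
    Integrable (fun q : V × Vᗮ => F (q.1 + q.2)) ((stdGaussian V).prod (stdGaussian Vᗮ)) := by
  rw [← map_prod_add_stdGaussian V] at hF
  exact hF.comp_measurable (by fun_prop)

lemma integral_stdGaussian_eq_integral_integral (V : Submodule ℝ E) {F : E → ℝ}
    (hF : Integrable F (stdGaussian E)) :
    ∫ x, F x ∂(stdGaussian E) =
      ∫ y : V, ∫ z : Vᗮ, F (y + z) ∂(stdGaussian Vᗮ) ∂(stdGaussian V) := by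
  rw [← integral_prod _ (integrable_comp_add_prod V hF), ← integral_map (f := F)
    (φ := fun q : V × Vᗮ => (q.1 : E) + (q.2 : E)) (by fun_prop), map_prod_add_stdGaussian]
  rw [map_prod_add_stdGaussian]
  exact hF.aestronglyMeasurable

lemma integral_comp_orthogonalProjectionOnto_mul (V : Submodule ℝ E) {ρ : E → ℝ} {h : V → ℝ}
    (hi : Integrable (fun x => ρ x * h (V.orthogonalProjectionOnto x)) (stdGaussian E)) :
    ∫ x, ρ x * h (V.orthogonalProjectionOnto x) ∂(stdGaussian E) =
      ∫ y, gaussMarginal V ρ y * h y ∂(stdGaussian V) := by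
  rw [integral_stdGaussian_eq_integral_integral V hi]
  simp_rw [orthogonalProjectionOnto_add_orthogonal, integral_mul_const]
  rfl

lemma integral_comp_orthogonalProjectionOnto (V : Submodule ℝ E) {h : V → ℝ}
    (hi : Integrable (fun x => h (V.orthogonalProjectionOnto x)) (stdGaussian E)) :
    ∫ x, h (V.orthogonalProjectionOnto x) ∂(stdGaussian E) = ∫ y, h y ∂(stdGaussian V) := by
  rw [integral_stdGaussian_eq_integral_integral V hi]
  simp_rw [orthogonalProjectionOnto_add_orthogonal]
  simp

namespace IsGaussDensity

variable {ρ : E → ℝ}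

lemma marginal (hρ : IsGaussDensity ρ) (V : Submodule ℝ E) :
    IsGaussDensity (gaussMarginal V ρ) where
  measurable := by
    have h : Measurable (fun q : V × Vᗮ => ρ (q.1 + q.2)) := hρ.measurable.comp (by fun_prop)
    exact h.stronglyMeasurable.integral_prod_right.measurable
  nonneg y := integral_nonneg fun z => hρ.nonneg _
  integral_eq_one := by
    rw [← hρ.integral_eq_one, integral_stdGaussian_eq_integral_integral V hρ.integrable]
    rfl

/-- Gibbs' variational inequality: `∫ ρ g dγ - log ∫ exp g dγ ≤ -S(ρ)`. -/
lemma integral_mul_sub_log_integral_exp_le (hρ : IsGaussDensity ρ)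
    (hlog : Integrable (fun x => ρ x * Real.log (ρ x)) (stdGaussian E)) {g : E → ℝ}
    (hg : Measurable g) {B : ℝ} (hB : ∀ x, |g x| ≤ B) :
    ∫ x, ρ x * g x ∂(stdGaussian E) - Real.log (∫ x, Real.exp (g x) ∂(stdGaussian E)) ≤
      ∫ x, ρ x * Real.log (ρ x) ∂(stdGaussian E) := by
  have hexp : Integrable (fun x => Real.exp (g x)) (stdGaussian E) :=
    Integrable.of_bound hg.exp.aestronglyMeasurable (Real.exp B) (ae_of_all _ fun x => by
      rw [Real.norm_of_nonneg (Real.exp_pos _).le]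
      exact Real.exp_le_exp.2 ((le_abs_self _).trans (hB x)))
  set Z := ∫ x, Real.exp (g x) ∂(stdGaussian E) with hZ
  have hZ0 : 0 < Z := integral_exp_pos hexp
  have hi1 := hρ.integrable_mul_bdd hg.aestronglyMeasurable hB
  have hi2 : Integrable (fun x => ρ x * g x - ρ x * Real.log Z) (stdGaussian E) :=
    hi1.sub (hρ.integrable.mul_const _)
  have hi3 : Integrable (fun x => ρ x * Real.log (ρ x) - ρ x) (stdGaussian E) :=
    hlog.sub hρ.integrable
  have hi4 : Integrable (fun x => ρ x * Real.log (ρ x) - ρ x + Real.exp (g x) / Z)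
      (stdGaussian E) := hi3.add (hexp.div_const Z)
  have hpt (x : E) : ρ x * g x - ρ x * Real.log Z ≤
      ρ x * Real.log (ρ x) - ρ x + Real.exp (g x) / Z := by
    -- For `ρ x > 0` this is `log u ≤ u - 1` at `u = exp (g x) / (Z ρ x)`.
    rcases (hρ.nonneg x).eq_or_lt with h0 | h0
    · rw [← h0]; simp; positivity
    · have hu : 0 < Real.exp (g x) / Z / ρ x := by positivity
      have h1 := Real.log_le_sub_one_of_pos hu
      rw [Real.log_div (by positivity) h0.ne', Real.log_div (Real.exp_pos _).ne' hZ0.ne',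
        Real.log_exp] at h1
      have h2 := mul_le_mul_of_nonneg_left h1 h0.le
      have h3 : ρ x * (Real.exp (g x) / Z / ρ x - 1) = Real.exp (g x) / Z - ρ x := by
        field_simp
      rw [h3] at h2
      linarith
  have h := integral_mono hi2 hi4 hpt
  rw [integral_sub hi1 (hρ.integrable.mul_const _), integral_mul_const, hρ.integral_eq_one,
    integral_add hi3 (hexp.div_const Z), integral_sub hlog hρ.integrable, hρ.integral_eq_one,
    integral_div, ← hZ, div_self hZ0.ne'] at h
  linarith

/-- Finiteness of the entropy passes to marginals, by Jensen's inequality for `r ↦ r log r` on the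
fibres. -/
lemma integrable_marginal_mul_log (hρ : IsGaussDensity ρ)
    (hlog : Integrable (fun x => ρ x * Real.log (ρ x)) (stdGaussian E)) (V : Submodule ℝ E) :
    Integrable (fun y => gaussMarginal V ρ y * Real.log (gaussMarginal V ρ y))
      (stdGaussian V) := by
  have h1 := integrable_comp_add_prod V hρ.integrable
  have h2 := integrable_comp_add_prod V hlog
  refine Integrable.mono' ((integrable_const 1).add h2.integral_prod_left.norm)
    ((hρ.marginal V).measurable.mul (hρ.marginal V).measurable.log).aestronglyMeasurable ?_
  filter_upwards [h1.prod_right_ae, h2.prod_right_ae] with y hy1 hy2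
  have h3 : gaussMarginal V ρ y * Real.log (gaussMarginal V ρ y) ≤
      ∫ z : Vᗮ, ρ (y + z) * Real.log (ρ (y + z)) ∂(stdGaussian Vᗮ) :=
    Real.convexOn_mul_log.map_integral_le Real.continuous_mul_log.continuousOn isClosed_Ici
      (ae_of_all _ fun z => hρ.nonneg _) hy1 hy2
  have h4 := sub_one_le_mul_log ((hρ.marginal V).nonneg y)
  have h5 := (hρ.marginal V).nonneg y
  rw [Real.norm_eq_abs, abs_le]
  simp only [Pi.add_apply, Real.norm_eq_abs]
  have h6 := le_abs_self (∫ z : Vᗮ, ρ (y + z) * Real.log (ρ (y + z)) ∂(stdGaussian Vᗮ))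
  have h7 := abs_nonneg (∫ z : Vᗮ, ρ (y + z) * Real.log (ρ (y + z)) ∂(stdGaussian Vᗮ))
  constructor <;> linarith

end IsGaussDensity

end Marginals

/-! ### Approximation in the Gibbs functional -/

section Gibbs

open Filter Topology

variable {E : Type*} [NormedAddCommGroup E] [InnerProductSpace ℝ E] [FiniteDimensional ℝ E]
  [MeasurableSpace E] [BorelSpace E]

/-- The Gibbs functional `∫ ρ g dγ - log ∫ exp g dγ`, whose supremum over `g` is `-S(ρ)`. -/
noncomputable def gibbs {W : Type*} [NormedAddCommGroup W] [InnerProductSpace ℝ W]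
    [FiniteDimensional ℝ W] [MeasurableSpace W] (ρ g : W → ℝ) : ℝ :=
  ∫ x, ρ x * g x ∂(stdGaussian W) - Real.log (∫ x, Real.exp (g x) ∂(stdGaussian W))

lemma tendsto_gibbs {ρ : E → ℝ} (hρ : IsGaussDensity ρ) {g : ℕ → E → ℝ} {g' : E → ℝ} {B : ℝ}
    (hg : ∀ k, Measurable (g k)) (hB : ∀ k x, |g k x| ≤ B)
    (hlim : ∀ᵐ x ∂(stdGaussian E), Tendsto (fun k => g k x) atTop (𝓝 (g' x))) :
    Tendsto (fun k => gibbs ρ (g k)) atTop (𝓝 (gibbs ρ g')) := by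
  have hexp : Tendsto (fun k => ∫ x, Real.exp (g k x) ∂(stdGaussian E)) atTop
      (𝓝 (∫ x, Real.exp (g' x) ∂(stdGaussian E))) := by
    refine tendsto_integral_of_dominated_convergence (fun _ => Real.exp B)
      (fun k => (hg k).exp.aestronglyMeasurable) (integrable_const _)
      (fun k => ae_of_all _ fun x => ?_) ?_
    · rw [Real.norm_of_nonneg (Real.exp_pos _).le]
      exact Real.exp_le_exp.2 ((le_abs_self _).trans (hB k x))
    · filter_upwards [hlim] with x hx using (Real.continuous_exp.tendsto _).comp hx
  have hpos : ∫ x, Real.exp (g' x) ∂(stdGaussian E) ≠ 0 := by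
    have h1 : Real.exp (-B) ≤ ∫ x, Real.exp (g' x) ∂(stdGaussian E) := by
      refine ge_of_tendsto' hexp fun k => ?_
      have h2 : Integrable (fun x => Real.exp (g k x)) (stdGaussian E) :=
        Integrable.of_bound (hg k).exp.aestronglyMeasurable (Real.exp B) (ae_of_all _ fun x => by
          rw [Real.norm_of_nonneg (Real.exp_pos _).le]
          exact Real.exp_le_exp.2 ((le_abs_self _).trans (hB k x)))
      simpa using integral_mono (integrable_const (Real.exp (-B))) h2
        fun x => Real.exp_le_exp.2 (neg_le_of_abs_le (hB k x))
    exact ((Real.exp_pos _).trans_le h1).ne'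
  refine Tendsto.sub ?_ (hexp.log hpos)
  refine tendsto_integral_of_dominated_convergence (fun x => ρ x * B)
    (fun k => (hρ.measurable.mul (hg k)).aestronglyMeasurable) (hρ.integrable.mul_const _)
    (fun k => ae_of_all _ fun x => ?_) ?_
  · rw [norm_mul, Real.norm_of_nonneg (hρ.nonneg x)]
    exact mul_le_mul_of_nonneg_left (hB k x) (hρ.nonneg x)
  · filter_upwards [hlim] with x hx using hx.const_mul _

/-- Smooth compactly supported `φ_k → tan (g / b)` a.e. give `b arctan φ_k → g`; passing through
`arctan` keeps the approximants bounded. -/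
lemma exists_tendsto_gibbs_smooth {ρ : E → ℝ} (hρ : IsGaussDensity ρ) {g : E → ℝ}
    (hg : Measurable g) {B : ℝ} (hB : ∀ x, |g x| ≤ B) :
    ∃ (b : ℝ) (φ : ℕ → E → ℝ), (∀ k, ContDiff ℝ 2 (φ k)) ∧ (∀ k, HasCompactSupport (φ k)) ∧
      Tendsto (fun k => gibbs ρ fun x => b * Real.arctan (φ k x)) atTop (𝓝 (gibbs ρ g)) := by
  -- With this `b` the quotient `g / b` stays in `[-1, 1]`, where `arctan` inverts `tan`.
  set b := max B 1 with hb
  have hb0 : 0 < b := zero_lt_one.trans_le (le_max_right _ _)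
  have hgb (x : E) : |g x / b| ≤ 1 := by
    rw [abs_div, abs_of_pos hb0, div_le_one hb0]
    exact (hB x).trans (le_max_left _ _)
  have hpi := Real.pi_gt_three
  have htan1 (x : E) : Real.arctan (Real.tan (g x / b)) = g x / b :=
    Real.arctan_tan (by linarith [(abs_le.1 (hgb x)).1]) (by linarith [(abs_le.1 (hgb x)).2])
  have hcont : ContinuousOn Real.tan (Set.Icc (-1) 1) := by
    refine Real.continuousOn_tan_Ioo.mono fun t ht => ⟨?_, ?_⟩
    · linarith [ht.1]
    · linarith [ht.2]
  obtain ⟨T, hT⟩ := isCompact_Icc.exists_bound_of_continuousOn hcont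
  have hmeas : Measurable fun x => Real.tan (g x / b) := by
    simp_rw [Real.tan_eq_sin_div_cos]
    exact (hg.div_const b).sin.div (hg.div_const b).cos
  have hψ : MemLp (fun x => Real.tan (g x / b)) 1 (stdGaussian E) :=
    MemLp.of_bound hmeas.aestronglyMeasurable T
      (ae_of_all _ fun x => hT _ (abs_le.1 (hgb x)))
  have happ (k : ℕ) := hψ.exist_eLpNorm_sub_le ENNReal.one_ne_top le_rfl
    (ε := 1 / ((k : ℝ) + 1)) (by positivity)
  choose φ hφ1 hφ2 hφ3 using happ
  have hLp : Tendsto (fun k => eLpNorm (φ k - fun x => Real.tan (g x / b)) 1 (stdGaussian E))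
      atTop (𝓝 0) := by
    have h0 : Tendsto (fun k : ℕ => ENNReal.ofReal (1 / ((k : ℝ) + 1))) atTop (𝓝 0) := by
      simpa [Function.comp_def] using (ENNReal.continuous_ofReal.tendsto _).comp
        (tendsto_one_div_add_atTop_nhds_zero_nat (𝕜 := ℝ))
    refine tendsto_of_tendsto_of_tendsto_of_le_of_le tendsto_const_nhds h0 (fun _ => zero_le)
      fun k => ?_
    rw [eLpNorm_sub_comm]
    exact hφ3 k
  have hmeasure := tendstoInMeasure_of_tendsto_eLpNorm one_ne_zero
    (fun k => (hφ2 k).continuous.aestronglyMeasurable) hmeas.aestronglyMeasurable hLp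
  obtain ⟨ns, -, hns⟩ := hmeasure.exists_seq_tendsto_ae
  refine ⟨b, fun k => φ (ns k), fun k => by exact_mod_cast contDiff_infty.1 (hφ2 _) 2,
    fun k => hφ1 _, ?_⟩
  refine tendsto_gibbs hρ (B := b * (Real.pi / 2)) (fun k => ?_) (fun k x => ?_) ?_
  · exact (Real.measurable_arctan.comp (hφ2 _).continuous.measurable).const_mul b
  · rw [abs_mul, abs_of_pos hb0]
    exact mul_le_mul_of_nonneg_left (abs_le.2 ⟨(Real.neg_pi_div_two_lt_arctan _).le,
      (Real.arctan_lt_pi_div_two _).le⟩) hb0.le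
  · filter_upwards [hns] with x hx
    have h1 := ((Real.continuous_arctan.tendsto _).comp hx).const_mul b
    rw [htan1, mul_div_cancel₀ _ hb0.ne'] at h1
    exact h1

/-- The supremum of the Gibbs functional is approached by the logarithms of the truncations of `ρ`
to `[1 / k, k]`, `k ≥ 1`. -/
lemma exists_tendsto_gibbs_entropy {ρ : E → ℝ} (hρ : IsGaussDensity ρ)
    (hlog : Integrable (fun x => ρ x * Real.log (ρ x)) (stdGaussian E)) :
    ∃ g : ℕ → E → ℝ, (∀ k, Measurable (g k)) ∧ (∀ k, ∃ B, ∀ x, |g k x| ≤ B) ∧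
      Tendsto (fun k => gibbs ρ (g k)) atTop
        (𝓝 (∫ x, ρ x * Real.log (ρ x) ∂(stdGaussian E))) := by
  set a : ℕ → ℝ := fun k => (k : ℝ) + 1 with ha
  have ha1 k : 1 ≤ a k := by simp [ha]
  have hainv k : (a k)⁻¹ ≤ 1 := inv_le_one_of_one_le₀ (ha1 k)
  have ha0 k : 0 < (a k)⁻¹ := inv_pos.2 (zero_lt_one.trans_le (ha1 k))
  set f : ℕ → E → ℝ := fun k x => max (a k)⁻¹ (min (ρ x) (a k)) with hf
  have hfm k : Measurable (f k) := measurable_const.max (hρ.measurable.min measurable_const)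
  have hf0 k x : 0 < f k x := (ha0 k).trans_le (le_max_left _ _)
  have hfa k x : f k x ≤ a k := max_le ((hainv k).trans (ha1 k)) (min_le_right _ _)
  have hfle k x : f k x ≤ 1 + ρ x :=
    max_le ((hainv k).trans (by linarith [hρ.nonneg x]))
      ((min_le_left _ _).trans (by linarith))
  have hatop : Tendsto a atTop atTop :=
    tendsto_atTop_add_const_right _ _ tendsto_natCast_atTop_atTop
  have hlim x : Tendsto (fun k => f k x) atTop (𝓝 (ρ x)) := by
    have h1 : Tendsto (fun k => min (ρ x) (a k)) atTop (𝓝 (ρ x)) := by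
      refine tendsto_const_nhds.congr' ?_
      filter_upwards [hatop.eventually_ge_atTop (ρ x)] with k hk
      rw [min_eq_left hk]
    simpa [max_eq_right (hρ.nonneg x)] using hatop.inv_tendsto_atTop.max h1
  refine ⟨fun k x => Real.log (f k x), fun k => (hfm k).log, fun k => ⟨Real.log (a k), ?_⟩, ?_⟩
  · intro x
    rw [abs_le, ← Real.log_inv]
    exact ⟨Real.log_le_log (ha0 k) (le_max_left _ _), Real.log_le_log (hf0 k x) (hfa k x)⟩
  · have h1 : Tendsto (fun k => ∫ x, Real.exp (Real.log (f k x)) ∂(stdGaussian E)) atTop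
        (𝓝 1) := by
      simp_rw [Real.exp_log (hf0 _ _)]
      rw [← hρ.integral_eq_one]
      refine tendsto_integral_of_dominated_convergence (fun x => 1 + ρ x)
        (fun k => (hfm k).aestronglyMeasurable) ((integrable_const _).add hρ.integrable)
        (fun k => ae_of_all _ fun x => ?_) (ae_of_all _ hlim)
      rw [Real.norm_of_nonneg (hf0 k x).le]
      exact hfle k x
    have h2 := (h1.log one_ne_zero)
    rw [Real.log_one] at h2
    have h3 : Tendsto (fun k => ∫ x, ρ x * Real.log (f k x) ∂(stdGaussian E)) atTop
        (𝓝 (∫ x, ρ x * Real.log (ρ x) ∂(stdGaussian E))) := by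
      refine tendsto_integral_of_dominated_convergence (fun x => |ρ x * Real.log (ρ x)|)
        (fun k => (hρ.measurable.mul (hfm k).log).aestronglyMeasurable) hlog.norm
        (fun k => ae_of_all _ fun x => ?_) (ae_of_all _ fun x => ?_)
      · rw [norm_mul, abs_mul, Real.norm_eq_abs, Real.norm_eq_abs]
        rcases (hρ.nonneg x).eq_or_lt with h0 | h0
        · rw [← h0]; simp
        · refine mul_le_mul_of_nonneg_left ?_ (abs_nonneg _)
          rcases le_total 1 (ρ x) with h | h
          · have h4 : 1 ≤ f k x := (le_min h (ha1 k)).trans (le_max_right _ _)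
            have h5 : f k x ≤ ρ x := max_le ((hainv k).trans h) (min_le_left _ _)
            rw [abs_of_nonneg (Real.log_nonneg h4), abs_of_nonneg (Real.log_nonneg h)]
            exact Real.log_le_log (hf0 k x) h5
          · have h4 : f k x ≤ 1 := max_le (hainv k) ((min_le_left _ _).trans h)
            have h5 : ρ x ≤ f k x := (le_min le_rfl (h.trans (ha1 k))).trans (le_max_right _ _)
            rw [abs_of_nonpos (Real.log_nonpos (hf0 k x).le h4),
              abs_of_nonpos (Real.log_nonpos h0.le h)]
            exact neg_le_neg (Real.log_le_log h0 h5)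
      · rcases (hρ.nonneg x).eq_or_lt with h0 | h0
        · rw [← h0]; simp
        · exact ((hlim x).log h0.ne').const_mul _
    simpa [gibbs] using h3.sub h2

end Gibbs

/-! ### The quadratic form condition -/

section QuadraticForm

variable {E : Type*} [NormedAddCommGroup E] [InnerProductSpace ℝ E] [FiniteDimensional ℝ E]

lemma sum_smul_starProjection_le_id_iff {ι : Type*} [Fintype ι] {c : ι → ℝ}
    {V : ι → Submodule ℝ E} :
    ∑ j, c j • (V j).starProjection ≤ ContinuousLinearMap.id ℝ E ↔
      ∀ w, ∑ j, c j * ‖(V j).starProjection w‖ ^ 2 ≤ ‖w‖ ^ 2 := by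
  have hsq j (w : E) : ⟪(V j).starProjection w, w⟫ = ‖(V j).starProjection w‖ ^ 2 := by
    rw [← real_inner_self_eq_norm_sq, Submodule.inner_starProjection_left_eq_right,
      Submodule.inner_starProjection_left_eq_right,
      Submodule.starProjection_eq_self_iff.2 (Submodule.starProjection_apply_mem _ _)]
  have hself : IsSelfAdjoint
      (ContinuousLinearMap.id ℝ E - ∑ j, c j • (V j).starProjection) :=
    (IsSelfAdjoint.one (E →L[ℝ] E)).sub (isSelfAdjoint_sum _ fun j _ =>
      (IsSelfAdjoint.all (c j)).smul (isSelfAdjoint_starProjection (V j)))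
  have hinner (w : E) : ⟪(ContinuousLinearMap.id ℝ E - ∑ j, c j • (V j).starProjection) w, w⟫ =
      ‖w‖ ^ 2 - ∑ j, c j * ‖(V j).starProjection w‖ ^ 2 := by
    simp only [sub_apply, ContinuousLinearMap.id_apply, sum_apply, smul_apply, inner_sub_left,
      sum_inner, real_inner_smul_left, real_inner_self_eq_norm_sq, hsq]
  rw [ContinuousLinearMap.le_def]
  constructor
  · intro h w
    have := h.inner_nonneg_left w
    rw [hinner] at this
    linarith
  · intro h
    refine ContinuousLinearMap.isPositive_def'.2 ⟨hself, fun w => ?_⟩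
    rw [ContinuousLinearMap.reApplyInnerSelf_apply, RCLike.re_to_real, hinner]
    linarith [h w]

/-- The dual form of `∑ c_j P_j ≤ I`: if `A : E → ⨁ V_j` has components `√c_j P_j`, the hypothesis
says `‖A‖ ≤ 1` and the conclusion `‖A*‖ ≤ 1`. -/
lemma norm_sum_smul_sq_le_of_sum_starProjection_le {ι : Type*} [Fintype ι] {c : ι → ℝ}
    (hc : ∀ j, 0 ≤ c j) {V : ι → Submodule ℝ E}
    (hV : ∑ j, c j • (V j).starProjection ≤ ContinuousLinearMap.id ℝ E)
    {v : ι → E} (hv : ∀ j, v j ∈ V j) : ‖∑ j, c j • v j‖ ^ 2 ≤ ∑ j, c j * ‖v j‖ ^ 2 := by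
  set u := ∑ j, c j • v j with hu
  have h1 : ‖u‖ ^ 2 = ∑ j, c j * ⟪v j, (V j).starProjection u⟫ := by
    rw [← real_inner_self_eq_norm_sq]
    nth_rewrite 1 [hu]
    rw [sum_inner]
    refine Finset.sum_congr rfl fun j _ => ?_
    rw [real_inner_smul_left, ← Submodule.inner_starProjection_left_eq_right,
      Submodule.starProjection_eq_self_iff.2 (hv j)]
  have h2 := sum_smul_starProjection_le_id_iff.1 hV u
  have h5 : ‖u‖ ^ 2 ≤ ∑ j, c j * ((‖v j‖ ^ 2 + ‖(V j).starProjection u‖ ^ 2) / 2) := by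
    rw [h1]
    refine Finset.sum_le_sum fun j _ => mul_le_mul_of_nonneg_left ?_ (hc j)
    have h6 := real_inner_le_norm (v j) ((V j).starProjection u)
    nlinarith [sq_nonneg (‖v j‖ - ‖(V j).starProjection u‖)]
  have h7 : ∑ j, c j * ((‖v j‖ ^ 2 + ‖(V j).starProjection u‖ ^ 2) / 2) =
      (∑ j, c j * ‖v j‖ ^ 2) / 2 + (∑ j, c j * ‖(V j).starProjection u‖ ^ 2) / 2 := by
    rw [Finset.sum_div, Finset.sum_div, ← Finset.sum_add_distrib]
    exact Finset.sum_congr rfl fun j _ => by ring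
  linarith

end QuadraticForm

/-! ### Subadditivity of the entropy -/

section Entropy

open Filter Topology

variable {E : Type*} [NormedAddCommGroup E] [InnerProductSpace ℝ E] [FiniteDimensional ℝ E]
  [MeasurableSpace E] [BorelSpace E]

/-- Gibbs' inequality for `∑ c_j g_j ∘ P_j`, with the partition function bounded by the
Brascamp–Lieb inequality. -/
lemma sum_gibbs_marginal_le_of_arctan {ι : Type*} [Fintype ι] {c : ι → ℝ}
    (hc : ∀ j, 0 ≤ c j) {V : ι → Submodule ℝ E}
    (hV : ∀ v : ι → E, (∀ j, v j ∈ V j) → ‖∑ j, c j • v j‖ ^ 2 ≤ ∑ j, c j * ‖v j‖ ^ 2)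
    {ρ : E → ℝ} (hρ : IsGaussDensity ρ)
    (hlog : Integrable (fun x => ρ x * Real.log (ρ x)) (stdGaussian E))
    (b : ι → ℝ) {φ : ∀ j, V j → ℝ} (hφ : ∀ j, ContDiff ℝ 2 (φ j))
    (hsupp : ∀ j, HasCompactSupport (φ j)) :
    ∑ j, c j * gibbs (gaussMarginal (V j) ρ) (fun y => b j * Real.arctan (φ j y)) ≤
      ∫ x, ρ x * Real.log (ρ x) ∂(stdGaussian E) := by
  have hreg j := exists_quadRegular_exp_arctan (hφ j) (hsupp j) (b j)
  choose R₀ hR₀ using hreg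
  obtain ⟨R, hR⟩ := Finite.exists_le R₀
  have hreg' j := hR₀ j (max R 1) ((hR j).trans (le_max_left _ _))
  choose G hG using hreg'
  have hR1 : 1 ≤ max R 1 := le_max_right _ _
  have hF j := (hG j).comp_orthogonalProjectionOnto (zero_le_one.trans hR1)
  set g : ∀ j, V j → ℝ := fun j y => b j * Real.arctan (φ j y) with hg
  have hgm j : Measurable (g j) :=
    (Real.measurable_arctan.comp (hφ j).continuous.measurable).const_mul _
  have hgB j y : |g j y| ≤ |b j| * (Real.pi / 2) := by
    rw [abs_mul]
    exact mul_le_mul_of_nonneg_left (abs_le.2 ⟨(Real.neg_pi_div_two_lt_arctan _).le,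
      (Real.arctan_lt_pi_div_two _).le⟩) (abs_nonneg _)
  have hBL := integral_prod_rpow_le_of_quadRegular hc hV hR1 hF fun j x => Subtype.coe_prop _
  have hFi j : Integrable (fun x => Real.exp (g j ((V j).orthogonalProjectionOnto x)))
      (stdGaussian E) := by
    simpa using (hF j).integrable hR1 1 0
  set Z : ι → ℝ := fun j => ∫ y, Real.exp (g j y) ∂(stdGaussian (V j)) with hZ
  have hZeq j : ∫ x, Real.exp (g j ((V j).orthogonalProjectionOnto x)) ∂(stdGaussian E) = Z j :=
    integral_comp_orthogonalProjectionOnto (V j) (h := fun y => Real.exp (g j y)) (hFi j)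
  have hZ0 j : 0 < Z j := by rw [← hZeq]; exact integral_exp_pos (hFi j)
  set H : E → ℝ := fun x => ∑ j, c j * g j ((V j).orthogonalProjectionOnto x) with hH
  have hHm : Measurable H := Finset.measurable_sum _ fun j _ =>
    ((hgm j).comp (by fun_prop)).const_mul _
  have hHB (x : E) : |H x| ≤ ∑ j, c j * (|b j| * (Real.pi / 2)) := by
    refine (Finset.abs_sum_le_sum_abs _ _).trans (Finset.sum_le_sum fun j _ => ?_)
    rw [abs_mul, abs_of_nonneg (hc j)]
    exact mul_le_mul_of_nonneg_left (hgB j _) (hc j)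
  have hgibbs := hρ.integral_mul_sub_log_integral_exp_le hlog hHm hHB
  have hexpH (x : E) : Real.exp (H x) =
      ∏ j, Real.exp (g j ((V j).orthogonalProjectionOnto x)) ^ c j := by
    rw [prod_rpow_eq_exp _ _ fun j => Real.exp_pos _]
    simp_rw [Real.log_exp]
    rfl
  have hlogZ : Real.log (∫ x, Real.exp (H x) ∂(stdGaussian E)) ≤ ∑ j, c j * Real.log (Z j) := by
    have hHi : Integrable (fun x => Real.exp (H x)) (stdGaussian E) :=
      Integrable.of_bound hHm.exp.aestronglyMeasurable _ (ae_of_all _ fun x => by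
        rw [Real.norm_of_nonneg (Real.exp_pos _).le]
        exact Real.exp_le_exp.2 ((le_abs_self _).trans (hHB x)))
    rw [Real.log_le_iff_le_exp (integral_exp_pos hHi), ← prod_rpow_eq_exp _ _ hZ0]
    simp_rw [hexpH, ← hZeq]
    exact hBL
  have hi j : Integrable (fun x => ρ x * g j ((V j).orthogonalProjectionOnto x))
      (stdGaussian E) :=
    hρ.integrable_mul_bdd ((hgm j).comp (by fun_prop)).aestronglyMeasurable fun x => hgB j _
  have hlin : ∫ x, ρ x * H x ∂(stdGaussian E) =
      ∑ j, c j * ∫ y, gaussMarginal (V j) ρ y * g j y ∂(stdGaussian (V j)) := by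
    simp only [hH, Finset.mul_sum]
    simp_rw [mul_left_comm (ρ _)]
    rw [integral_finsetSum _ fun j _ => (hi j).const_mul _]
    refine Finset.sum_congr rfl fun j _ => ?_
    rw [integral_const_mul, integral_comp_orthogonalProjectionOnto_mul (V j) (hi j)]
  rw [hlin] at hgibbs
  simp only [gibbs, mul_sub, Finset.sum_sub_distrib]
  linarith

/-- Subadditivity of the entropy for densities of finite entropy. -/
theorem sum_mul_integral_marginal_mul_log_le {ι : Type*} [Fintype ι] {c : ι → ℝ}
    (hc : ∀ j, 0 ≤ c j) {V : ι → Submodule ℝ E}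
    (hV : ∀ v : ι → E, (∀ j, v j ∈ V j) → ‖∑ j, c j • v j‖ ^ 2 ≤ ∑ j, c j * ‖v j‖ ^ 2)
    {ρ : E → ℝ} (hρ : IsGaussDensity ρ)
    (hlog : Integrable (fun x => ρ x * Real.log (ρ x)) (stdGaussian E)) :
    ∑ j, c j * ∫ y, gaussMarginal (V j) ρ y * Real.log (gaussMarginal (V j) ρ y)
        ∂(stdGaussian (V j)) ≤
      ∫ x, ρ x * Real.log (ρ x) ∂(stdGaussian E) := by
  have hbdd (g : ∀ j, V j → ℝ) (hg : ∀ j, Measurable (g j)) (hB : ∀ j, ∃ B, ∀ y, |g j y| ≤ B) :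
      ∑ j, c j * gibbs (gaussMarginal (V j) ρ) (g j) ≤
        ∫ x, ρ x * Real.log (ρ x) ∂(stdGaussian E) := by
    choose B hB using hB
    have h j := exists_tendsto_gibbs_smooth (hρ.marginal (V j)) (hg j) (hB j)
    choose b φ h1 h2 h3 using h
    exact le_of_tendsto' (tendsto_finsetSum _ fun j _ => (h3 j).const_mul (c j)) fun k =>
      sum_gibbs_marginal_le_of_arctan hc hV hρ hlog b (fun j => h1 j k) fun j => h2 j k
  have h j := exists_tendsto_gibbs_entropy (hρ.marginal (V j))
    (hρ.integrable_marginal_mul_log hlog (V j))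
  choose g h1 h2 h3 using h
  exact le_of_tendsto' (tendsto_finsetSum _ fun j _ => (h3 j).const_mul (c j)) fun k =>
    hbdd (fun j => g j k) (fun j => h1 j k) fun j => h2 j k

end Entropy

/-! ### Translated Gaussians -/

section Shift

variable {E : Type*} [NormedAddCommGroup E] [InnerProductSpace ℝ E] [FiniteDimensional ℝ E]
  [MeasurableSpace E] [BorelSpace E]

/-- The density of the translate by `w` of the standard Gaussian measure, relative to the standard
Gaussian measure itself. -/
noncomputable def shiftDensity (w : E) (x : E) : ℝ := Real.exp (⟪w, x⟫ - ‖w‖ ^ 2 / 2)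

lemma integral_shiftDensity (w : E) : ∫ x, shiftDensity w x ∂(stdGaussian E) = 1 := by
  simp_rw [shiftDensity, Real.exp_sub, integral_div, integral_exp_inner_stdGaussian]
  exact div_self (Real.exp_pos _).ne'

lemma isGaussDensity_shiftDensity (w : E) : IsGaussDensity (shiftDensity w) where
  measurable := by unfold shiftDensity; fun_prop
  nonneg x := (Real.exp_pos _).le
  integral_eq_one := integral_shiftDensity w

lemma gaussEntropy_shiftDensity (w : E) :
    gaussEntropy (shiftDensity w) = ((-(‖w‖ ^ 2 / 2) : ℝ) : EReal) := by
  have heq : (fun x => shiftDensity w x * Real.log (shiftDensity w x)) = fun x =>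
      ⟪w, x⟫ * Real.exp ⟪w, x⟫ / Real.exp (‖w‖ ^ 2 / 2) - shiftDensity w x * (‖w‖ ^ 2 / 2) := by
    ext x
    rw [shiftDensity, Real.log_exp, Real.exp_sub]
    ring
  have h1 := (integrable_inner_mul_exp_inner_stdGaussian w).div_const (Real.exp (‖w‖ ^ 2 / 2))
  have h2 := (isGaussDensity_shiftDensity w).integrable.mul_const (‖w‖ ^ 2 / 2)
  have h3 : Integrable (fun x => ⟪w, x⟫ * Real.exp ⟪w, x⟫ / Real.exp (‖w‖ ^ 2 / 2) -
      shiftDensity w x * (‖w‖ ^ 2 / 2)) (stdGaussian E) := h1.sub h2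
  rw [gaussEntropy, heq, if_pos h3, integral_sub h1 h2, integral_div, integral_mul_const,
    integral_inner_mul_exp_inner_stdGaussian, integral_shiftDensity,
    mul_div_cancel_right₀ _ (Real.exp_pos _).ne']
  congr 2
  ring

lemma gaussMarginal_shiftDensity (V : Submodule ℝ E) (w : E) :
    gaussMarginal V (shiftDensity w) = shiftDensity (V.orthogonalProjectionOnto w) := by
  ext y
  have h1 (z : Vᗮ) : shiftDensity w ((y : E) + z) =
      shiftDensity (V.orthogonalProjectionOnto w) y *
        shiftDensity (Vᗮ.orthogonalProjectionOnto w) z := by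
    have h2 := V.norm_sq_eq_add_norm_sq_projection w
    simp only [shiftDensity]
    rw [← Real.exp_add, inner_add_right, h2,
      Submodule.inner_orthogonalProjectionOnto_eq_of_mem_right,
      Submodule.inner_orthogonalProjectionOnto_eq_of_mem_right]
    congr 1
    ring
  simp_rw [gaussMarginal, h1, integral_const_mul, integral_shiftDensity, mul_one]

end Shift

/-! ### The inequality with extended real entropies -/

section Subadditivity

variable {E : Type*} [NormedAddCommGroup E] [InnerProductSpace ℝ E] [FiniteDimensional ℝ E]
  [MeasurableSpace E] [BorelSpace E] {N : ℕ} {V : Fin N → Submodule ℝ E} {p : Fin N → ℝ} {C : ℝ}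

lemma EReal.coe_finsetSum {ι : Type*} (s : Finset ι) (f : ι → ℝ) :
    ((∑ j ∈ s, f j : ℝ) : EReal) = ∑ j ∈ s, (f j : EReal) := by
  classical
  induction s using Finset.induction_on with
  | empty => simp
  | insert a s ha ih => rw [Finset.sum_insert ha, Finset.sum_insert ha, EReal.coe_add, ih]

theorem gaussSubadditivity_one (hp : ∀ j, 0 ≤ 1 / p j)
    (hV : ∑ j, (1 / p j) • (V j).starProjection ≤ ContinuousLinearMap.id ℝ E) :
    GaussSubadditivity V p 1 := by
  intro ρ hρ
  rw [ge_iff_le, Real.log_one, EReal.coe_zero, sub_zero]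
  by_cases hlog : Integrable (fun x => ρ x * Real.log (ρ x)) (stdGaussian E)
  · have h := sum_mul_integral_marginal_mul_log_le hp
      (fun v hv => norm_sum_smul_sq_le_of_sum_starProjection_le hp hV hv) hρ hlog
    simp only [gaussEntropy, if_pos hlog, if_pos (hρ.integrable_marginal_mul_log hlog _)]
    simp_rw [← EReal.coe_mul]
    rw [← EReal.coe_finsetSum, EReal.coe_le_coe_iff]
    simp_rw [mul_neg]
    rw [Finset.sum_neg_distrib]
    exact neg_le_neg h
  · rw [gaussEntropy, if_neg hlog]
    exact bot_le

/-- The inequality tested on the translate of the Gaussian by `w`: its entropy is `-‖w‖² / 2`, and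
its marginals are translates by the projections of `w`. -/
lemma GaussSubadditivity.sum_mul_norm_sq_le (h : GaussSubadditivity V p C) (w : E) :
    (∑ j, 1 / p j * ‖(V j).starProjection w‖ ^ 2) / 2 ≤ ‖w‖ ^ 2 / 2 + Real.log C := by
  have h1 := h (shiftDensity w) (isGaussDensity_shiftDensity w)
  simp_rw [gaussMarginal_shiftDensity, gaussEntropy_shiftDensity, ← EReal.coe_mul] at h1
  rw [← EReal.coe_finsetSum, ← EReal.coe_sub, ge_iff_le, EReal.coe_le_coe_iff] at h1
  have h2 : ∑ j, 1 / p j * -(‖(V j).orthogonalProjectionOnto w‖ ^ 2 / 2) =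
      -((∑ j, 1 / p j * ‖(V j).starProjection w‖ ^ 2) / 2) := by
    rw [Finset.sum_div, ← Finset.sum_neg_distrib]
    refine Finset.sum_congr rfl fun j _ => ?_
    rw [Submodule.starProjection_apply, Submodule.coe_norm]
    ring
  rw [h2] at h1
  linarith

lemma GaussSubadditivity.sum_starProjection_le (h : GaussSubadditivity V p C) :
    ∑ j, (1 / p j) • (V j).starProjection ≤ ContinuousLinearMap.id ℝ E := by
  refine sum_smul_starProjection_le_id_iff.2 fun w => ?_
  by_contra! hw
  set a := ∑ j, 1 / p j * ‖(V j).starProjection w‖ ^ 2 with ha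
  have hC : 0 ≤ Real.log C := by simpa using h.sum_mul_norm_sq_le 0
  have hpos : 0 < a - ‖w‖ ^ 2 := sub_pos.2 hw
  -- Scaling `w` by `√s` multiplies the quadratic terms by `s` but leaves `log C` fixed.
  set s := 2 * (Real.log C + 1) / (a - ‖w‖ ^ 2) with hs
  have hs0 : 0 ≤ s := by positivity
  have h1 := h.sum_mul_norm_sq_le (√s • w)
  have h2 : ∑ j, 1 / p j * ‖(V j).starProjection (√s • w)‖ ^ 2 = s * a := by
    rw [ha, Finset.mul_sum]
    refine Finset.sum_congr rfl fun j _ => ?_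
    rw [map_smul, norm_smul, mul_pow, Real.norm_of_nonneg (Real.sqrt_nonneg s), Real.sq_sqrt hs0]
    ring
  rw [h2, norm_smul, mul_pow, Real.norm_of_nonneg (Real.sqrt_nonneg s), Real.sq_sqrt hs0] at h1
  have h3 : s * (a - ‖w‖ ^ 2) = 2 * (Real.log C + 1) := div_mul_cancel₀ _ hpos.ne'
  linarith

end Subadditivity

theorem mainTheorem7 (n N : ℕ) (V : Fin N → Submodule ℝ (EuclideanSpace ℝ (Fin n)))
    (hV : ∀ j, V j ≠ ⊥) (p : Fin N → ℝ) (hp : ∀ j, 1 ≤ p j) :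
    ((∃ C : ℝ, 0 < C ∧ GaussSubadditivity V p C) ↔
      ∑ j, (1 / p j) • (V j).starProjection ≤
        ContinuousLinearMap.id ℝ (EuclideanSpace ℝ (Fin n))) ∧
    (∑ j, (1 / p j) • (V j).starProjection ≤
        ContinuousLinearMap.id ℝ (EuclideanSpace ℝ (Fin n)) →
      IsLeast {C : ℝ | 0 < C ∧ GaussSubadditivity V p C} 1) := by
  have hp0 j : 0 ≤ 1 / p j := one_div_nonneg.2 (zero_le_one.trans (hp j))
  refine ⟨⟨fun ⟨C, _, h⟩ => h.sum_starProjection_le,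
    fun h => ⟨1, one_pos, gaussSubadditivity_one hp0 h⟩⟩,
    fun h => ⟨⟨one_pos, gaussSubadditivity_one hp0 h⟩, fun C ⟨hC, hsub⟩ => ?_⟩⟩
  have h0 := hsub.sum_mul_norm_sq_le 0
  simp only [map_zero, norm_zero, ne_eq, OfNat.ofNat_ne_zero, not_false_eq_true, zero_pow, mul_zero,
    Finset.sum_const_zero, zero_div, zero_add] at h0
  exact (Real.log_nonneg_iff hC).1 h0
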